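/- Let $V=\{1,\dots,N\}$ ($N\ge 1$) be a set of agents on the vertices of an undirected graph $G$, let $A=\{1,\dots,K\}$ ($K\ge 1$) be the set of actions, and let each agent $v$ have a delay $d(v)\in\{0,1,2,\dots\}$ and a time-to-live $ttl(v)\in\{0,1,2,\dots\}$. Let $G_{\mathcal P}$ be the directed graph on $V$ with an arc $(v',v)$ if and only if $\mathrm{dist}_G(v',v)\le\min\{d(v),ttl(v')\}$ (so all self-loops are present); let $N^-_{\mathcal P}(v)$ be the in-neighbourhood of $v$ in it and $\alpha(G_{\mathcal P})$ the independence number of the undirected graph obtained from it by disregarding orientation. Let $\bar d_V=\frac1N\sum_{v\in V}d(v)$. Exp3-Coop2 with learning rate $\eta>0$ and exploration parameter $\delta>0$ sets $w_1(i,v)=1$ and, in round $t=1,2,\dots$, every agent $v$ draws (independently of the other agents, given the past) an action $I_t(v)$ from $$p_t(i,v)=\frac{\widetilde p_t(i,v)}{\sum_{j\in A}\widetilde p_t(j,v)},\qquad \widetilde p_t(i,v)=\max\Big\{\frac{w_t(i,v)}{\sum_{j\in A} w_t(j,v)},\frac{\delta}{K}\Big\},$$ and then sets $w_{t+1}(i,v)=p_t(i,v)\,e^{-\eta\,\widehat\ell_t(i,v)}$,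 where $\widehat\ell_t(i,v)=0$ if $t\le d(v)$ and otherwise, with $s=t-d(v)$, $$\widehat\ell_t(i,v)=\frac{\ell_s(i)}{q_s(i,v)}\,\mathbb 1\{\exists v'\in N^-_{\mathcal P}(v): I_s(v')=i\},\qquad q_s(i,v)=1-\prod_{v'\in N^-_{\mathcal P}(v)}\big(1-p_s(i,v')\big).$$ The losses $\ell_t(i)\in[0,1]$ are fixed in advance (oblivious adversary). The average welfare regret is $$R_T^{\mathrm{coop}}=\frac1N\sum_{v\in V}\mathbb E\Big[\sum_{t=1}^T\ell_t(I_t(v))\Big]-\min_{i\in A}\sum_{t=1}^T\ell_t(i).$$ Theorem. There is an absolute constant $C>0$ such that for all $K$, $N$, $G$, $\{d(v),ttl(v)\}_{v\in V}$ as above and all learning rates $\eta=\eta(T)>0$ with $\eta(T)\to0$ as $T\to\infty$, there is a $T_0$ such that for all $T\ge T_0$ and all loss sequences with values in $[0,1]$, Exp3-Coop2 run with learning rate $\eta=\eta(T)$ and exploration parameter $\delta=1/T$ satisfies $$R_T^{\mathrm{coop}}\le C\left(\frac{\ln K}{\eta}+\eta\Big(\bar d_V+\frac KN\,\alpha(G_{\mathcal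 P})\ln(TNK)\Big)T\right).$$ -/

import Mathlib

open Filter Topology

namespace Exp3Coop2

/-! Agents are the elements of `V`, actions the elements of `A`.  Rounds are numbered
`0, 1, 2, …` (a run over `T` rounds uses the rounds `0, …, T - 1`), so "round `s` is at
least `d` rounds old at round `t`" reads `d ≤ t`, with `s = t - d`. -/

/-- The directed communication graph induced by the individual delays `d` and the individual
times-to-live `ttl`: there is an arc from `v'` to `v` iff the shortest-path distance between
them in `G` is at most `min (d v) (ttl v')`.  (The extended distance is `⊤` between different
components of `G`.)  All self-loops are present. -/
noncomputable def commDigraph {V : Type*} (G : SimpleGraph V) (d ttl : V → ℕ) : Digraph V where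
  Adj v' v := G.edist v' v ≤ ((min (d v) (ttl v') : ℕ) : ℕ∞)

/-- Independence number of a directed graph: the independence number of the undirected graph
obtained by disregarding the orientation of the arcs (and the self-loops). -/
noncomputable def digraphIndepNum {V : Type*} (D : Digraph V) : ℕ :=
  D.toSimpleGraphInclusive.indepNum

open scoped Classical in
/-- The in-neighbourhood of `v`. -/
noncomputable def inNeighbors {V : Type*} [Fintype V] (D : Digraph V) (v : V) : Finset V :=
  Finset.univ.filter fun v' => D.Adj v' v

/-- `max {w i / ∑ j, w j, δ / K}`, where `K` is the number of actions. -/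
noncomputable def truncated {A : Type*} [Fintype A] (δ : ℝ) (w : A → ℝ) (i : A) : ℝ :=
  max (w i / ∑ j, w j) (δ / Fintype.card A)

/-- The distribution over actions computed from the weights `w`: the truncated normalized weights,
normalized again. -/
noncomputable def actionDist {A : Type*} [Fintype A] (δ : ℝ) (w : A → ℝ) (i : A) : ℝ :=
  truncated δ w i / ∑ j, truncated δ w j

/-- `1 - ∏ (1 - p v' i)` over the in-neighbours `v'` of `v`: the probability that some in-neighbour
of `v` plays `i`, when each agent `v'` draws its action from `p v'` independently. -/
noncomputable def observeProb {V A : Type*} [Fintype V] (D : Digraph V) (p : V → A → ℝ)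
    (v : V) (i : A) : ℝ :=
  1 - ∏ v' ∈ inNeighbors D v, (1 - p v' i)

open scoped Classical in
/-- Indicator that some in-neighbour of `v` plays `i`, when agent `v'` plays `x v'`. -/
noncomputable def observed {V A : Type*} [Fintype V] (D : Digraph V) (x : V → A)
    (v : V) (i : A) : ℝ :=
  if ∃ v' ∈ inNeighbors D v, x v' = i then 1 else 0

/-- The weight of action `i` for agent `v` in round `t`, when the actions played are given by `I`
(agent `v` plays `I s v` in round `s`), the losses by `ℓ` (action `i` has loss `ℓ s i` in round `s`),
with communication digraph `D`, delays `d`, learning rate `η` and exploration parameter `δ`.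
See `weight_zero` and `weight_succ` for the update rule in terms of `prob` and `lossEst`. -/
noncomputable def weight {V A : Type*} [Fintype V] [Fintype A] (D : Digraph V) (d : V → ℕ)
    (η δ : ℝ) (ℓ : ℕ → A → ℝ) (I : ℕ → V → A) : ℕ → V → A → ℝ
  | 0, _, _ => 1
  | t + 1, v, i =>
      actionDist δ (fun j => weight D d η δ ℓ I t v j) i *
        Real.exp (-η *
          (if d v ≤ t then
            ℓ (t - d v) i /
              observeProb D
                (fun v' => actionDist δ (fun j => weight D d η δ ℓ I (t - d v) v' j)) v i *
              observed D (I (t - d v)) v i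
          else 0))
termination_by t => t

/-- The probability with which agent `v` plays action `i` in round `t`. -/
noncomputable def prob {V A : Type*} [Fintype V] [Fintype A] (D : Digraph V) (d : V → ℕ)
    (η δ : ℝ) (ℓ : ℕ → A → ℝ) (I : ℕ → V → A) (t : ℕ) (v : V) (i : A) : ℝ :=
  actionDist δ (weight D d η δ ℓ I t v) i

/-- The delayed importance-weighted loss estimate that agent `v` uses in round `t`. -/
noncomputable def lossEst {V A : Type*} [Fintype V] [Fintype A] (D : Digraph V) (d : V → ℕ)
    (η δ : ℝ) (ℓ : ℕ → A → ℝ) (I : ℕ → V → A) (t : ℕ) (v : V) (i : A) : ℝ :=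
  if d v ≤ t then
    ℓ (t - d v) i / observeProb D (prob D d η δ ℓ I (t - d v)) v i * observed D (I (t - d v)) v i
  else 0

theorem weight_zero {V A : Type*} [Fintype V] [Fintype A] (D : Digraph V) (d : V → ℕ)
    (η δ : ℝ) (ℓ : ℕ → A → ℝ) (I : ℕ → V → A) (v : V) (i : A) :
    weight D d η δ ℓ I 0 v i = 1 := by
  rw [weight]

/-- The update rule. -/
theorem weight_succ {V A : Type*} [Fintype V] [Fintype A] (D : Digraph V) (d : V → ℕ)
    (η δ : ℝ) (ℓ : ℕ → A → ℝ) (I : ℕ → V → A) (t : ℕ) (v : V) (i : A) :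
    weight D d η δ ℓ I (t + 1) v i =
      prob D d η δ ℓ I t v i * Real.exp (-η * lossEst D d η δ ℓ I t v i) := by
  rw [weight]
  rfl

/-- The actions of the rounds `0, …, T - 1`, extended by an arbitrary action to all later rounds
(no action of a round `≥ T` is ever used). -/
noncomputable def extend {V A : Type*} [Nonempty A] {T : ℕ} (a : Fin T → V → A) : ℕ → V → A :=
  fun t v => if h : t < T then a ⟨t, h⟩ v else Classical.arbitrary A

/-- The probability that the actions of the rounds `0, …, T - 1` are `a`: in each round, given the
past, the agents draw their actions independently from their current distributions. -/
noncomputable def trajProb {V A : Type*} [Fintype V] [Fintype A] [Nonempty A] (D : Digraph V)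
    (d : V → ℕ) (η δ : ℝ) (ℓ : ℕ → A → ℝ) (T : ℕ) (a : Fin T → V → A) : ℝ :=
  ∏ t : Fin T, ∏ v : V, prob D d η δ ℓ (extend a) t v (a t v)

/-- Expectation of a function of the actions of the rounds `0, …, T - 1`. -/
noncomputable def expect {V A : Type*} [Fintype V] [DecidableEq V] [Fintype A] [Nonempty A]
    (D : Digraph V) (d : V → ℕ) (η δ : ℝ) (ℓ : ℕ → A → ℝ) (T : ℕ)
    (F : (Fin T → V → A) → ℝ) : ℝ :=
  ∑ a : Fin T → V → A, trajProb D d η δ ℓ T a * F a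

/-- The average welfare regret after `T` rounds. -/
noncomputable def welfareRegret {V A : Type*} [Fintype V] [DecidableEq V] [Fintype A] [Nonempty A]
    (D : Digraph V) (d : V → ℕ) (η δ : ℝ) (ℓ : ℕ → A → ℝ) (T : ℕ) : ℝ :=
  (1 / (Fintype.card V : ℝ)) *
      ∑ v : V, expect D d η δ ℓ T (fun a => ∑ t : Fin T, ℓ t (a t v)) -
    ⨅ i : A, ∑ t ∈ Finset.range T, ℓ t i

/-- The average delay. -/
noncomputable def avgDelay {V : Type*} [Fintype V] (d : V → ℕ) : ℝ :=
  (1 / (Fintype.card V : ℝ)) * ∑ v : V, (d v : ℝ)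

/-! The probabilities `prob` and `trajProb` are indeed probabilities. -/

theorem truncated_pos {A : Type*} [Fintype A] [Nonempty A] {δ : ℝ} (hδ : 0 < δ) (w : A → ℝ)
    (i : A) : 0 < truncated δ w i :=
  lt_max_of_lt_right (div_pos hδ (by exact_mod_cast Fintype.card_pos))

theorem prob_pos {V A : Type*} [Fintype V] [Fintype A] [Nonempty A] (D : Digraph V)
    (d : V → ℕ) (η : ℝ) {δ : ℝ} (hδ : 0 < δ) (ℓ : ℕ → A → ℝ) (I : ℕ → V → A) (t : ℕ) (v : V)
    (i : A) : 0 < prob D d η δ ℓ I t v i :=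
  div_pos (truncated_pos hδ _ _)
    (Finset.sum_pos (fun _ _ => truncated_pos hδ _ _) Finset.univ_nonempty)

theorem sum_prob {V A : Type*} [Fintype V] [Fintype A] [Nonempty A] (D : Digraph V)
    (d : V → ℕ) (η : ℝ) {δ : ℝ} (hδ : 0 < δ) (ℓ : ℕ → A → ℝ) (I : ℕ → V → A) (t : ℕ) (v : V) :
    ∑ i, prob D d η δ ℓ I t v i = 1 := by
  unfold prob actionDist
  rw [← Finset.sum_div]
  exact div_self
    (Finset.sum_pos (fun _ _ => truncated_pos hδ _ _) Finset.univ_nonempty).ne'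

/-- The weights of round `t` depend only on the actions of the earlier rounds. -/
theorem weight_congr {V A : Type*} [Fintype V] [Fintype A] (D : Digraph V)
    (d : V → ℕ) (η δ : ℝ) (ℓ : ℕ → A → ℝ) (I J : ℕ → V → A) (t : ℕ)
    (h : ∀ s, s < t → I s = J s) : weight D d η δ ℓ I t = weight D d η δ ℓ J t := by
  induction t using Nat.strong_induction_on with
  | _ t ih =>
    funext v i
    cases t with
    | zero => rw [weight_zero, weight_zero]
    | succ t =>
      have h1 := ih t (by omega) (fun s hs => h s (by omega))
      have h2 := ih (t - d v) (by omega) (fun s hs => h s (by omega))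
      have h3 := h (t - d v) (by omega)
      rw [weight_succ, weight_succ]
      unfold lossEst
      have h4 : prob D d η δ ℓ I t = prob D d η δ ℓ J t := by
        funext v i; unfold prob; rw [h1]
      have h5 : prob D d η δ ℓ I (t - d v) = prob D d η δ ℓ J (t - d v) := by
        funext v i; unfold prob; rw [h2]
      rw [h3, h4, h5]

theorem trajProb_nonneg {V A : Type*} [Fintype V] [Fintype A] [Nonempty A] (D : Digraph V)
    (d : V → ℕ) (η : ℝ) {δ : ℝ} (hδ : 0 < δ) (ℓ : ℕ → A → ℝ) (T : ℕ) (a : Fin T → V → A) :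
    0 ≤ trajProb D d η δ ℓ T a :=
  Finset.prod_nonneg fun _ _ => Finset.prod_nonneg fun _ _ => (prob_pos D d η hδ ℓ _ _ _ _).le

theorem sum_trajProb {V A : Type*} [Fintype V] [DecidableEq V] [Fintype A] [Nonempty A]
    (D : Digraph V) (d : V → ℕ) (η : ℝ) {δ : ℝ} (hδ : 0 < δ) (ℓ : ℕ → A → ℝ) (T : ℕ) :
    ∑ a : Fin T → V → A, trajProb D d η δ ℓ T a = 1 := by
  induction T with
  | zero => simp [trajProb]
  | succ T ih =>
    have key : ∀ (x : V → A) (a : Fin T → V → A),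
        trajProb D d η δ ℓ (T + 1) (Fin.snoc (α := fun _ => V → A) a x) =
          trajProb D d η δ ℓ T a * ∏ v, prob D d η δ ℓ (extend a) T v (x v) := by
      intro x a
      have hp : ∀ t, t ≤ T →
          prob D d η δ ℓ (extend (Fin.snoc (α := fun _ => V → A) a x)) t =
            prob D d η δ ℓ (extend a) t := by
        intro t ht
        have hw := weight_congr D d η δ ℓ
          (extend (Fin.snoc (α := fun _ => V → A) a x)) (extend a) t (by
            intro s hs
            funext v
            have hsT : s < T := by omega
            simp [extend, hsT, Nat.lt_succ_of_lt hsT, Fin.snoc])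
        funext v i
        unfold prob
        rw [hw]
      unfold trajProb
      rw [Fin.prod_univ_castSucc]
      congr 1
      · refine Finset.prod_congr rfl fun t _ => Finset.prod_congr rfl fun v _ => ?_
        rw [Fin.val_castSucc, hp t t.2.le, Fin.snoc_castSucc]
      · refine Finset.prod_congr rfl fun v _ => ?_
        rw [Fin.val_last, hp T le_rfl, Fin.snoc_last]
    rw [← (Fin.snocEquiv (fun _ : Fin (T + 1) => V → A)).sum_comp, Fintype.sum_prod_type_right]
    have hone : ∀ a : Fin T → V → A,
        ∑ x : V → A, ∏ v, prob D d η δ ℓ (extend a) T v (x v) = 1 := by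
      intro a
      rw [← Fintype.prod_sum]
      exact Finset.prod_eq_one fun v _ => sum_prob D d η hδ ℓ _ T v
    calc _ = ∑ a : Fin T → V → A, trajProb D d η δ ℓ T a *
          ∑ x : V → A, ∏ v, prob D d η δ ℓ (extend a) T v (x v) := by
            refine Finset.sum_congr rfl fun a _ => ?_
            rw [Finset.mul_sum]
            exact Finset.sum_congr rfl fun x _ => key x a
      _ = 1 := by simp only [hone, mul_one, ih]

end Exp3Coop2

/-! Each agent runs exponential weights on its own delayed importance-weighted estimates, so for
every path of actions its estimated regret is at most `log K / η` plus `η` times a second moment.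
The estimate used in round `s + d v` is unbiased given the rounds before `s`, and the distribution
used in that round depends on those rounds only, so taking expectations turns estimates into
losses. Evaluating the loss of round `s` on the distribution of round `s + d v` costs a drift of
at most `d v * (δ + η)`. Since `p (s + d v) ≤ 2 * p s`, the second moments are controlled by
`∑ i, p i v / q i v`; summed over the agents, these are at most `N + O (K α log (T N K))` by a
greedy argument on the communication graph, a weighted form of the Caro–Wei bound. -/

namespace Exp3Coop2

section InMass

variable {V : Type*} {r : V → V → Prop} {w : V → ℝ} {S S' : Finset V} {v : V}

open scoped Classical in
/-- The total weight of the `r`-in-neighbours of `v` inside `S`. -/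
noncomputable def inMass (r : V → V → Prop) (w : V → ℝ) (S : Finset V) (v : V) : ℝ :=
  ∑ u ∈ S with r u v, w u

theorem inMass_pos (hw : ∀ u, 0 < w u) (hr : r v v) (hv : v ∈ S) : 0 < inMass r w S v := by
  classical
  exact Finset.sum_pos (fun u _ => hw u) ⟨v, Finset.mem_filter.2 ⟨hv, hr⟩⟩

theorem inMass_mono (hw : ∀ u, 0 ≤ w u) (h : S ⊆ S') : inMass r w S v ≤ inMass r w S' v := by
  classical
  exact Finset.sum_le_sum_of_subset_of_nonneg (Finset.filter_subset_filter _ h) fun u _ _ => hw u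

theorem sum_mul_inMass_swap :
    ∑ v ∈ S, w v * inMass (fun u v => r v u) w S v = ∑ v ∈ S, w v * inMass r w S v := by
  simp only [inMass, Finset.sum_filter, Finset.mul_sum]
  rw [Finset.sum_comm]
  simp only [mul_ite, mul_zero, mul_comm]

theorem sum_mul_inMass_or_swap_le (hw : ∀ u, 0 ≤ w u) :
    ∑ v ∈ S, w v * inMass (fun u v => r u v ∨ r v u) w S v ≤
      2 * ∑ v ∈ S, w v * inMass r w S v := by
  have h_or (v : V) : inMass (fun u v => r u v ∨ r v u) w S v ≤
      inMass r w S v + inMass (fun u v => r v u) w S v := by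
    classical
    simp only [inMass, Finset.filter_or]
    rw [← Finset.sum_union_inter]
    exact le_add_of_nonneg_right (Finset.sum_nonneg fun u _ => hw u)
  calc ∑ v ∈ S, w v * inMass (fun u v => r u v ∨ r v u) w S v
      ≤ ∑ v ∈ S, (w v * inMass r w S v + w v * inMass (fun u v => r v u) w S v) := by
        gcongr with v
        rw [← mul_add]
        exact mul_le_mul_of_nonneg_left (h_or v) (hw v)
    _ = 2 * ∑ v ∈ S, w v * inMass r w S v := by
        rw [Finset.sum_add_distrib, sum_mul_inMass_swap, two_mul]

open scoped Classical in
theorem sum_filter_div_inMass_le_one (hw : ∀ u, 0 < w u) (hr : r v v) (hv : v ∈ S)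
    (hmin : ∀ u ∈ S, inMass r w S v ≤ inMass r w S u) :
    ∑ u ∈ S with r u v, w u / inMass r w S u ≤ 1 := by
  have hpos : 0 < inMass r w S v := inMass_pos hw hr hv
  calc ∑ u ∈ S with r u v, w u / inMass r w S u
      ≤ ∑ u ∈ S with r u v, w u / inMass r w S v :=
        Finset.sum_le_sum fun u hu =>
          div_le_div_of_nonneg_left (hw u).le hpos (hmin u (Finset.mem_filter.1 hu).1)
    _ = 1 := by rw [← Finset.sum_div]; exact div_self hpos.ne'

theorem div_sum_le_log_sub_log_erase [DecidableEq V] (hw : ∀ u, 0 < w u) (hv : v ∈ S)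
    (hne : (S.erase v).Nonempty) :
    w v / ∑ u ∈ S, w u ≤ Real.log (∑ u ∈ S, w u) - Real.log (∑ u ∈ S.erase v, w u) := by
  have hS : 0 < ∑ u ∈ S, w u := Finset.sum_pos (fun u _ => hw u) ⟨v, hv⟩
  have hE : 0 < ∑ u ∈ S.erase v, w u := Finset.sum_pos (fun u _ => hw u) hne
  have hsplit : w v = ∑ u ∈ S, w u - ∑ u ∈ S.erase v, w u := by
    rw [← Finset.add_sum_erase S w hv, add_sub_cancel_right]
  calc w v / ∑ u ∈ S, w u = 1 - ((∑ u ∈ S, w u) / ∑ u ∈ S.erase v, w u)⁻¹ := by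
        rw [inv_div, hsplit, sub_div, div_self hS.ne']
    _ ≤ Real.log ((∑ u ∈ S, w u) / ∑ u ∈ S.erase v, w u) :=
        Real.one_sub_inv_le_log_of_pos (div_pos hS hE)
    _ = _ := Real.log_div hS.ne' hE.ne'

/- Weighted Caro–Wei bound: a vertex of minimal in-mass is moved into the independent set and
its neighbourhood is discarded. -/
theorem exists_pairwise_not_sum_div_inMass_le_card (hw : ∀ u, 0 < w u) (hrefl : ∀ v, r v v)
    (hsymm : ∀ u v, r u v → r v u) (S : Finset V) :
    ∃ t ⊆ S, (t : Set V).Pairwise (fun u v => ¬ r u v) ∧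
      ∑ v ∈ S, w v / inMass r w S v ≤ t.card := by
  classical
  induction S using Finset.strongInduction with
  | H S ih =>
    obtain rfl | hS := S.eq_empty_or_nonempty
    · exact ⟨∅, by simp⟩
    obtain ⟨v, hv, hmin⟩ := S.exists_min_image (inMass r w S) hS
    set N := {u ∈ S | r u v}
    have hNS : N ⊆ S := Finset.filter_subset _ S
    have hvN : v ∈ N := Finset.mem_filter.2 ⟨hv, hrefl v⟩
    obtain ⟨t, htN, ht, hsum⟩ := ih (S \ N) (Finset.sdiff_ssubset hNS ⟨v, hvN⟩)
    have hvt : v ∉ t := fun h => (Finset.mem_sdiff.1 (htN h)).2 hvN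
    refine ⟨insert v t, Finset.insert_subset hv (htN.trans Finset.sdiff_subset), ?_, ?_⟩
    · rw [Finset.coe_insert]
      refine ht.insert fun u hu _ => ?_
      obtain ⟨huS, huN⟩ := Finset.mem_sdiff.1 (htN hu)
      have huv : ¬ r u v := fun h => huN (Finset.mem_filter.2 ⟨huS, h⟩)
      exact ⟨fun h => huv (hsymm v u h), huv⟩
    · have hrest : ∑ u ∈ S \ N, w u / inMass r w S u ≤ t.card :=
        le_trans (Finset.sum_le_sum fun u hu => div_le_div_of_nonneg_left (hw u).le
          (inMass_pos hw (hrefl u) hu) (inMass_mono (fun x => (hw x).le) Finset.sdiff_subset)) hsum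
      rw [Finset.card_insert_of_notMem hvt, Nat.cast_add_one, ← Finset.sum_sdiff hNS]
      exact add_le_add hrest (sum_filter_div_inMass_le_one hw (hrefl v) hv hmin)

end InMass

section IndepNum

variable {V : Type*} [Finite V] (D : Digraph V) {w : V → ℝ} {S : Finset V}

theorem card_le_digraphIndepNum {t : Finset V}
    (ht : (t : Set V).Pairwise fun u v => ¬ (D.Adj u v ∨ D.Adj v u)) :
    t.card ≤ digraphIndepNum D :=
  SimpleGraph.IsIndepSet.card_le_indepNum fun _ hu _ hv huv h => ht hu hv huv h.2

theorem one_le_digraphIndepNum [Nonempty V] : 1 ≤ digraphIndepNum D :=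
  card_le_digraphIndepNum D (t := {Classical.arbitrary V}) (by simp)

variable {D}

theorem sum_div_inMass_or_swap_le (hD : ∀ v, D.Adj v v) (hw : ∀ u, 0 < w u) (S : Finset V) :
    ∑ v ∈ S, w v / inMass (fun u v => D.Adj u v ∨ D.Adj v u) w S v ≤ digraphIndepNum D := by
  obtain ⟨t, -, ht, hsum⟩ := exists_pairwise_not_sum_div_inMass_le_card
    (r := fun u v => D.Adj u v ∨ D.Adj v u) hw (fun v => Or.inl (hD v)) (fun _ _ => Or.symm) S
  exact hsum.trans (Nat.cast_le.2 (card_le_digraphIndepNum D ht))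

theorem sq_sum_le_digraphIndepNum_mul (hD : ∀ v, D.Adj v v) (hw : ∀ u, 0 < w u) (S : Finset V) :
    (∑ v ∈ S, w v) ^ 2 ≤ 2 * digraphIndepNum D * ∑ v ∈ S, w v * inMass D.Adj w S v := by
  set Q := inMass (fun u v => D.Adj u v ∨ D.Adj v u) w S
  have hQ (v) (hv : v ∈ S) : 0 < Q v := inMass_pos hw (Or.inl (hD v)) hv
  calc (∑ v ∈ S, w v) ^ 2
      ≤ (∑ v ∈ S, w v / Q v) * ∑ v ∈ S, w v * Q v :=
        Finset.sum_sq_le_sum_mul_sum_of_sq_le_mul S (fun v hv => (div_pos (hw v) (hQ v hv)).le)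
          (fun v hv => (mul_pos (hw v) (hQ v hv)).le) fun v hv => by
            rw [div_mul_eq_mul_div, mul_div_assoc, mul_div_cancel_right₀ _ (hQ v hv).ne', sq]
    _ ≤ digraphIndepNum D * (2 * ∑ v ∈ S, w v * inMass D.Adj w S v) :=
        mul_le_mul (sum_div_inMass_or_swap_le hD hw S)
          (sum_mul_inMass_or_swap_le fun u => (hw u).le)
          (Finset.sum_nonneg fun v hv => (mul_pos (hw v) (hQ v hv)).le) (Nat.cast_nonneg _)
    _ = 2 * digraphIndepNum D * ∑ v ∈ S, w v * inMass D.Adj w S v := by ring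

theorem exists_sum_le_digraphIndepNum_mul_inMass (hD : ∀ v, D.Adj v v) (hw : ∀ u, 0 < w u)
    (hS : S.Nonempty) :
    ∃ v ∈ S, ∑ u ∈ S, w u ≤ 2 * digraphIndepNum D * inMass D.Adj w S v := by
  obtain ⟨v, hv, hle⟩ : ∃ v ∈ S, w v * ∑ u ∈ S, w u ≤
      w v * (2 * digraphIndepNum D * inMass D.Adj w S v) := by
    refine Finset.exists_le_of_sum_le hS ?_
    rw [← Finset.sum_mul, ← sq]
    refine (sq_sum_le_digraphIndepNum_mul hD hw S).trans_eq ?_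
    rw [Finset.mul_sum]
    exact Finset.sum_congr rfl fun v _ => by ring
  exact ⟨v, hv, le_of_mul_le_mul_left hle (hw v)⟩

theorem exists_div_inMass_le (hD : ∀ v, D.Adj v v) (hw : ∀ u, 0 < w u) (hS : S.Nonempty) :
    ∃ v ∈ S, w v / inMass D.Adj w S v ≤ 2 * digraphIndepNum D * (w v / ∑ u ∈ S, w u) := by
  obtain ⟨v, hv, hle⟩ := exists_sum_le_digraphIndepNum_mul_inMass hD hw hS
  refine ⟨v, hv, ?_⟩
  rw [mul_div_assoc', div_le_div_iff₀ (inMass_pos hw (hD v) hv)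
    (Finset.sum_pos (fun u _ => hw u) hS)]
  calc w v * ∑ u ∈ S, w u ≤ w v * (2 * digraphIndepNum D * inMass D.Adj w S v) :=
        mul_le_mul_of_nonneg_left hle (hw v).le
    _ = 2 * digraphIndepNum D * w v * inMass D.Adj w S v := by ring

/- Vertices whose in-mass is at least a fraction `1 / (2 α)` of what is left are removed one by
one; the resulting sum of relative decrements of the total mass telescopes to a logarithm. -/
theorem sum_div_inMass_le {ε : ℝ} (hD : ∀ v, D.Adj v v) (hε : 0 < ε) (hw : ∀ u, ε ≤ w u)
    (hS : S.Nonempty) :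
    ∑ v ∈ S, w v / inMass D.Adj w S v ≤
      2 * digraphIndepNum D * (1 + Real.log ((∑ v ∈ S, w v) / ε)) := by
  have hpos (u) : 0 < w u := hε.trans_le (hw u)
  have hsum {S' : Finset V} (hS' : S'.Nonempty) : 0 < ∑ u ∈ S', w u :=
    Finset.sum_pos (fun u _ => hpos u) hS'
  classical
  induction S using Finset.strongInduction with
  | H S ih =>
    obtain ⟨v, hv, hle⟩ := exists_div_inMass_le hD hpos hS
    rw [← Finset.add_sum_erase S _ hv]
    obtain hE | hE := (S.erase v).eq_empty_or_nonempty
    · have hlog : 0 ≤ Real.log ((∑ u ∈ S, w u) / ε) := by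
        refine Real.log_nonneg ((one_le_div hε).2 ((hw v).trans ?_))
        exact Finset.single_le_sum (fun u _ => (hpos u).le) hv
      rw [hE, Finset.sum_empty, add_zero]
      refine hle.trans (mul_le_mul_of_nonneg_left ?_ (by positivity))
      exact (div_le_one_of_le₀ (Finset.single_le_sum (fun u _ => (hpos u).le) hv)
        (hsum hS).le).trans (le_add_of_nonneg_right hlog)
    · have hrest : ∑ u ∈ S.erase v, w u / inMass D.Adj w S u ≤
          2 * digraphIndepNum D * (1 + Real.log ((∑ u ∈ S.erase v, w u) / ε)) :=
        le_trans (Finset.sum_le_sum fun u hu => div_le_div_of_nonneg_left (hpos u).le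
          (inMass_pos hpos (hD u) hu) (inMass_mono (fun x => (hpos x).le) (S.erase_subset v)))
          (ih _ (Finset.erase_ssubset hv) hE)
      refine (add_le_add hle hrest).trans ?_
      rw [← mul_add]
      refine mul_le_mul_of_nonneg_left ?_ (by positivity)
      rw [Real.log_div (hsum hE).ne' hε.ne', Real.log_div (hsum hS).ne' hε.ne']
      linarith [div_sum_le_log_sub_log_erase hpos hv hE]

end IndepNum

section ObserveProb

variable {V A : Type*} [Fintype V] {D : Digraph V} {p : V → A → ℝ} {v : V} {i : A}

theorem prod_one_sub_le_inv_one_add_sum {ι : Type*} (s : Finset ι) {x : ι → ℝ}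
    (hx : ∀ j, 0 ≤ x j) (hx1 : ∀ j, x j ≤ 1) :
    ∏ j ∈ s, (1 - x j) ≤ (1 + ∑ j ∈ s, x j)⁻¹ := by
  have hsum : 0 ≤ ∑ j ∈ s, x j := Finset.sum_nonneg fun j _ => hx j
  calc ∏ j ∈ s, (1 - x j) ≤ ∏ j ∈ s, Real.exp (-x j) :=
        Finset.prod_le_prod (fun j _ => sub_nonneg.2 (hx1 j))
          fun j _ => Real.one_sub_le_exp_neg _
    _ = (Real.exp (∑ j ∈ s, x j))⁻¹ := by
        rw [← Real.exp_sum, Finset.sum_neg_distrib, Real.exp_neg]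
    _ ≤ (1 + ∑ j ∈ s, x j)⁻¹ :=
        inv_anti₀ (by positivity) (by linarith [Real.add_one_le_exp (∑ j ∈ s, x j)])

theorem le_observeProb (hD : D.Adj v v) (hp : ∀ u j, 0 ≤ p u j) (hp1 : ∀ u j, p u j ≤ 1) :
    p v i ≤ observeProb D p v i := by
  classical
  have hv : v ∈ inNeighbors D v := Finset.mem_filter.2 ⟨Finset.mem_univ v, hD⟩
  have herase : ∏ u ∈ (inNeighbors D v).erase v, (1 - p u i) ≤ 1 :=
    Finset.prod_le_one (fun u _ => sub_nonneg.2 (hp1 u i)) fun u _ => sub_le_self 1 (hp u i)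
  rw [observeProb, ← Finset.mul_prod_erase _ _ hv]
  linarith [mul_le_of_le_one_right (sub_nonneg.2 (hp1 v i)) herase]

theorem inMass_div_le_observeProb (hp : ∀ u j, 0 ≤ p u j) (hp1 : ∀ u j, p u j ≤ 1) :
    inMass D.Adj (p · i) Finset.univ v / (1 + inMass D.Adj (p · i) Finset.univ v) ≤
      observeProb D p v i := by
  have hm : 0 ≤ inMass D.Adj (p · i) Finset.univ v := Finset.sum_nonneg fun u _ => hp u i
  have hprod : ∏ u ∈ inNeighbors D v, (1 - p u i) ≤
      (1 + inMass D.Adj (p · i) Finset.univ v)⁻¹ :=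
    prod_one_sub_le_inv_one_add_sum _ (fun u => hp u i) fun u => hp1 u i
  calc inMass D.Adj (p · i) Finset.univ v / (1 + inMass D.Adj (p · i) Finset.univ v)
      = 1 - (1 + inMass D.Adj (p · i) Finset.univ v)⁻¹ := by field_simp; ring
    _ ≤ observeProb D p v i := sub_le_sub_left hprod 1

theorem div_observeProb_le (hD : D.Adj v v) (hp : ∀ u j, 0 < p u j) (hp1 : ∀ u j, p u j ≤ 1) :
    p v i / observeProb D p v i ≤ p v i + p v i / inMass D.Adj (p · i) Finset.univ v := by
  have hm : 0 < inMass D.Adj (p · i) Finset.univ v :=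
    inMass_pos (fun u => hp u i) hD (Finset.mem_univ v)
  calc p v i / observeProb D p v i
      ≤ p v i /
        (inMass D.Adj (p · i) Finset.univ v / (1 + inMass D.Adj (p · i) Finset.univ v)) :=
        div_le_div_of_nonneg_left (hp v i).le (by positivity)
          (inMass_div_le_observeProb (fun u j => (hp u j).le) hp1)
    _ = p v i + p v i / inMass D.Adj (p · i) Finset.univ v := by field_simp; ring

theorem observed_nonneg (x : V → A) (v : V) (i : A) : 0 ≤ observed D x v i := by
  unfold observed; split_ifs <;> simp

theorem observed_le_one (x : V → A) (v : V) (i : A) : observed D x v i ≤ 1 := by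
  unfold observed; split_ifs <;> simp

variable [Fintype A]

/-- The second moment, under `p v`, of agent `v`'s importance-weighted estimates of unit losses:
the quantity that the communication between the agents keeps small. -/
noncomputable def varianceProxy (D : Digraph V) (p : V → A → ℝ) (v : V) : ℝ :=
  ∑ i, p v i / observeProb D p v i

theorem sum_varianceProxy_le [Nonempty V] {ε : ℝ} (hD : ∀ v, D.Adj v v) (hε : 0 < ε)
    (hp : ∀ v i, ε ≤ p v i) (hsum : ∀ v, ∑ i, p v i = 1) :
    ∑ v, varianceProxy D p v ≤ Fintype.card V +
      Fintype.card A * (2 * digraphIndepNum D * (1 + Real.log (Fintype.card V / ε))) := by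
  have hpos (v i) : 0 < p v i := hε.trans_le (hp v i)
  have hp1 (v i) : p v i ≤ 1 :=
    hsum v ▸ Finset.single_le_sum (fun j _ => (hpos v j).le) (Finset.mem_univ i)
  have hmass (i : A) : ∑ v, p v i / inMass D.Adj (p · i) Finset.univ v ≤
      2 * digraphIndepNum D * (1 + Real.log (Fintype.card V / ε)) := by
    have htotal : 0 < ∑ v, p v i := Finset.sum_pos (fun v _ => hpos v i) Finset.univ_nonempty
    refine (sum_div_inMass_le hD hε (hp · i) Finset.univ_nonempty).trans ?_
    gcongr
    exact (Finset.sum_le_card_nsmul _ _ 1 fun v _ => hp1 v i).trans_eq (by simp)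
  calc ∑ v, varianceProxy D p v
      ≤ ∑ v, ∑ i, (p v i + p v i / inMass D.Adj (p · i) Finset.univ v) :=
        Finset.sum_le_sum fun v _ => Finset.sum_le_sum fun i _ =>
          div_observeProb_le (hD v) hpos hp1
    _ = Fintype.card V + ∑ i, ∑ v, p v i / inMass D.Adj (p · i) Finset.univ v := by
        simp only [Finset.sum_add_distrib, hsum]
        rw [Finset.sum_comm (s := Finset.univ (α := V)), Finset.sum_const, nsmul_one,
          Finset.card_univ]
    _ ≤ _ := by
        gcongr
        exact (Finset.sum_le_card_nsmul _ _ _ fun i _ => hmass i).trans_eq (nsmul_eq_mul _ _)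

end ObserveProb

section ActionDist

variable {A : Type*} [Fintype A] [Nonempty A] {δ : ℝ} {w : A → ℝ}

theorem sum_truncated_le (hδ : 0 < δ) (hw : ∀ i, 0 < w i) : ∑ i, truncated δ w i ≤ 1 + δ := by
  have hW : 0 < ∑ j, w j := Finset.sum_pos (fun i _ => hw i) Finset.univ_nonempty
  calc ∑ i, truncated δ w i ≤ ∑ i, (w i / ∑ j, w j + δ / Fintype.card A) :=
        Finset.sum_le_sum fun i _ =>
          max_le_add_of_nonneg (div_pos (hw i) hW).le (by positivity)
    _ = 1 + δ := by
        rw [Finset.sum_add_distrib, ← Finset.sum_div, div_self hW.ne', Finset.sum_const,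
          Finset.card_univ, nsmul_eq_mul, mul_div_cancel₀ δ (by positivity)]

theorem one_le_sum_truncated (hw : ∀ i, 0 < w i) : 1 ≤ ∑ i, truncated δ w i := by
  have hW : 0 < ∑ j, w j := Finset.sum_pos (fun i _ => hw i) Finset.univ_nonempty
  calc 1 = ∑ i, w i / ∑ j, w j := by rw [← Finset.sum_div, div_self hW.ne']
    _ ≤ ∑ i, truncated δ w i := Finset.sum_le_sum fun i _ => le_max_left _ _

theorem div_le_actionDist_of_le_truncated {x : ℝ} {i : A} (hδ : 0 < δ) (hw : ∀ i, 0 < w i)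
    (hx : x ≤ truncated δ w i) : x / (1 + δ) ≤ actionDist δ w i :=
  div_le_div₀ (truncated_pos hδ w i).le hx
    (zero_lt_one.trans_le (one_le_sum_truncated hw)) (sum_truncated_le hδ hw)

theorem actionDist_le_truncated (hδ : 0 < δ) (hw : ∀ i, 0 < w i) (i : A) :
    actionDist δ w i ≤ truncated δ w i :=
  div_le_self (truncated_pos hδ w i).le (one_le_sum_truncated hw)

end ActionDist

section ExpUpdate

variable {A : Type*} {δ η ρ : ℝ} {p L : A → ℝ} {i k : A}

/-- The exponential-weights update: the weights obtained from the distribution `p` upon seeing the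
loss vector `L`, with learning rate `η`. -/
noncomputable def expUpdate (η : ℝ) (p L : A → ℝ) (i : A) : ℝ :=
  p i * Real.exp (-η * L i)

theorem exp_neg_le_one_sub_add_sq {x : ℝ} (hx : 0 ≤ x) : Real.exp (-x) ≤ 1 - x + x ^ 2 := by
  rw [Real.exp_neg, inv_le_iff_one_le_mul₀ (Real.exp_pos x)]
  calc 1 ≤ (1 - x + x ^ 2) * (x + 1) := by nlinarith [pow_nonneg hx 3]
    _ ≤ (1 - x + x ^ 2) * Real.exp x := by
        gcongr
        · nlinarith [sq_nonneg (x - 1)]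
        · exact Real.add_one_le_exp x

theorem expUpdate_pos (hp : 0 < p i) : 0 < expUpdate η p L i :=
  mul_pos hp (Real.exp_pos _)

theorem expUpdate_le (hη : 0 ≤ η) (hp : 0 ≤ p i) (hL : 0 ≤ L i) : expUpdate η p L i ≤ p i :=
  mul_le_of_le_one_right hp (Real.exp_le_one_iff.2 (by nlinarith [mul_nonneg hη hL]))

theorem mul_one_sub_le_expUpdate (hp : 0 ≤ p i) : p i * (1 - η * L i) ≤ expUpdate η p L i := by
  rw [expUpdate, neg_mul]
  exact mul_le_mul_of_nonneg_left (Real.one_sub_le_exp_neg _) hp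

theorem log_expUpdate (hp : 0 < p i) : Real.log (expUpdate η p L i) = Real.log (p i) - η * L i := by
  rw [expUpdate, Real.log_mul hp.ne' (Real.exp_pos _).ne', Real.log_exp, neg_mul, sub_eq_add_neg]

variable [Fintype A]

theorem sum_expUpdate_le_one (hη : 0 ≤ η) (hp : ∀ i, 0 ≤ p i) (hp1 : ∑ i, p i = 1)
    (hL : ∀ i, 0 ≤ L i) : ∑ i, expUpdate η p L i ≤ 1 :=
  (Finset.sum_le_sum fun i _ => expUpdate_le hη (hp i) (hL i)).trans_eq hp1

theorem one_sub_le_sum_expUpdate (hp : ∀ i, 0 ≤ p i) (hp1 : ∑ i, p i = 1) :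
    1 - η * (p ⬝ᵥ L) ≤ ∑ i, expUpdate η p L i := by
  calc 1 - η * (p ⬝ᵥ L) = ∑ i, p i * (1 - η * L i) := by
        simp only [dotProduct, mul_sub, mul_one, Finset.sum_sub_distrib, hp1, Finset.mul_sum,
          mul_left_comm]
    _ ≤ ∑ i, expUpdate η p L i := Finset.sum_le_sum fun i _ => mul_one_sub_le_expUpdate (hp i)

theorem sum_expUpdate_le (hη : 0 ≤ η) (hp : ∀ i, 0 ≤ p i) (hp1 : ∑ i, p i = 1)
    (hL : ∀ i, 0 ≤ L i) :
    ∑ i, expUpdate η p L i ≤ 1 - η * (p ⬝ᵥ L) + η ^ 2 * (p ⬝ᵥ L ^ 2) := by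
  calc ∑ i, expUpdate η p L i ≤ ∑ i, p i * (1 - η * L i + (η * L i) ^ 2) :=
        Finset.sum_le_sum fun i _ => by
          rw [expUpdate, neg_mul]
          exact mul_le_mul_of_nonneg_left
            (exp_neg_le_one_sub_add_sq (mul_nonneg hη (hL i))) (hp i)
    _ = 1 - η * (p ⬝ᵥ L) + η ^ 2 * (p ⬝ᵥ L ^ 2) := by
        simp only [dotProduct, mul_add, mul_sub, mul_one, Finset.sum_add_distrib,
          Finset.sum_sub_distrib, hp1, Finset.mul_sum, mul_pow, Pi.pow_apply, mul_left_comm]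

variable [Nonempty A]

theorem mul_dotProduct_sub_le_log_actionDist (hδ : 0 < δ) (hη : 0 ≤ η) (hp : ∀ i, 0 < p i)
    (hp1 : ∑ i, p i = 1) (hL : ∀ i, 0 ≤ L i) (k : A) :
    η * (p ⬝ᵥ L) - η ^ 2 * (p ⬝ᵥ L ^ 2) ≤
      Real.log (actionDist δ (expUpdate η p L) k) - Real.log (p k) + η * L k + δ := by
  have hpos (i) : 0 < expUpdate η p L i := expUpdate_pos (hp i)
  have hsum : 0 < ∑ i, expUpdate η p L i := Finset.sum_pos (fun i _ => hpos i) Finset.univ_nonempty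
  have hlog := Real.log_le_log (by have := hpos k; positivity)
    (div_le_actionDist_of_le_truncated (i := k) hδ hpos (le_max_left _ _))
  rw [Real.log_div (div_pos (hpos k) hsum).ne' (by positivity),
    Real.log_div (hpos k).ne' hsum.ne', log_expUpdate (hp k)] at hlog
  have hlog_sum := Real.log_le_sub_one_of_pos hsum
  have hlog_δ := Real.log_le_sub_one_of_pos (by positivity : 0 < 1 + δ)
  linarith [sum_expUpdate_le hη (fun i => (hp i).le) hp1 hL]

theorem mul_le_actionDist_expUpdate (hδ : 0 < δ) (hη : 0 ≤ η) (hp : ∀ i, 0 < p i)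
    (hp1 : ∑ i, p i = 1) (hL : ∀ i, 0 ≤ L i) (i : A) :
    p i * (1 - δ - η * L i) ≤ actionDist δ (expUpdate η p L) i := by
  have hpos (i) : 0 < expUpdate η p L i := expUpdate_pos (hp i)
  have hsum : 0 < ∑ i, expUpdate η p L i := Finset.sum_pos (fun i _ => hpos i) Finset.univ_nonempty
  have hηL : 0 ≤ η * L i := mul_nonneg hη (hL i)
  refine le_trans ?_ (div_le_actionDist_of_le_truncated hδ hpos
    ((le_div_self (hpos i).le hsum
      (sum_expUpdate_le_one hη (fun i => (hp i).le) hp1 hL)).trans (le_max_left _ _)))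
  rw [le_div_iff₀ (by positivity)]
  calc p i * (1 - δ - η * L i) * (1 + δ) ≤ p i * (1 - η * L i) := by
        rw [mul_assoc]
        exact mul_le_mul_of_nonneg_left
          (by nlinarith [mul_nonneg hηL hδ.le, sq_nonneg δ]) (hp i).le
    _ ≤ expUpdate η p L i := mul_one_sub_le_expUpdate (hp i).le

theorem dotProduct_le_actionDist_expUpdate_dotProduct_add {f : A → ℝ} (hδ : 0 < δ) (hη : 0 ≤ η)
    (hp : ∀ i, 0 < p i) (hp1 : ∑ i, p i = 1) (hL : ∀ i, 0 ≤ L i) (hf0 : 0 ≤ f) (hf1 : f ≤ 1) :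
    p ⬝ᵥ f ≤ actionDist δ (expUpdate η p L) ⬝ᵥ f + (δ + η * (p ⬝ᵥ L)) := by
  have hterm (i) : p i * f i ≤
      actionDist δ (expUpdate η p L) i * f i + (p i * δ + η * (p i * L i)) := by
    have hloss : 0 ≤ p i * δ + η * (p i * L i) :=
      add_nonneg (mul_nonneg (hp i).le hδ.le) (mul_nonneg hη (mul_nonneg (hp i).le (hL i)))
    calc p i * f i = p i * (1 - δ - η * L i) * f i + (p i * δ + η * (p i * L i)) * f i := by ring
      _ ≤ _ := add_le_add
          (mul_le_mul_of_nonneg_right (mul_le_actionDist_expUpdate hδ hη hp hp1 hL i) (hf0 i))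
          (mul_le_of_le_one_right hloss (hf1 i))
  calc p ⬝ᵥ f
      ≤ ∑ i, (actionDist δ (expUpdate η p L) i * f i + (p i * δ + η * (p i * L i))) :=
        Finset.sum_le_sum fun i _ => hterm i
    _ = actionDist δ (expUpdate η p L) ⬝ᵥ f + (δ + η * (p ⬝ᵥ L)) := by
        simp only [dotProduct, Finset.sum_add_distrib, ← Finset.sum_mul, ← Finset.mul_sum, hp1,
          one_mul]

theorem mul_actionDist_expUpdate_le (hδ : 0 < δ) (hη : 0 ≤ η) (hp : ∀ i, 0 < p i)
    (hp1 : ∑ i, p i = 1) (hL : ∀ i, 0 ≤ L i) (hpδ : δ / Fintype.card A / (1 + δ) ≤ p i)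
    (hδρ : δ ≤ ρ) (hρ1 : ρ ≤ 1) (hρ : η * (p ⬝ᵥ L) ≤ ρ) :
    (1 - ρ) * actionDist δ (expUpdate η p L) i ≤ p i := by
  have hpos (i) : 0 < expUpdate η p L i := expUpdate_pos (hp i)
  have hsum : 0 < ∑ i, expUpdate η p L i := Finset.sum_pos (fun i _ => hpos i) Finset.univ_nonempty
  have hsum_ge : 1 - ρ ≤ ∑ i, expUpdate η p L i :=
    (sub_le_sub_left hρ 1).trans (one_sub_le_sum_expUpdate (fun i => (hp i).le) hp1)
  refine (mul_le_mul_of_nonneg_left (actionDist_le_truncated hδ hpos i) (by linarith)).trans ?_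
  rw [truncated, mul_max_of_nonneg _ _ (by linarith)]
  refine max_le ?_ (le_trans ?_ hpδ)
  · rw [mul_div_assoc', div_le_iff₀ hsum, mul_comm]
    exact mul_le_mul (expUpdate_le hη (hp i).le (hL i)) hsum_ge (by linarith) (hp i).le
  · rw [le_div_iff₀ (by positivity), mul_right_comm]
    exact mul_le_of_le_one_left (by positivity)
      (by nlinarith [sq_nonneg δ, mul_nonneg (sub_nonneg.2 hδρ) hδ.le])

end ExpUpdate

section Path

variable {V A : Type*} [Fintype V] [Fintype A] {D : Digraph V} {d : V → ℕ} {η δ ρ : ℝ}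
  {ℓ : ℕ → A → ℝ} {I : ℕ → V → A} {v : V} {i : A}

local notation "𝐩" => prob D d η δ ℓ
local notation "𝐋" => lossEst D d η δ ℓ

theorem prob_succ (t : ℕ) (v : V) :
    𝐩 I (t + 1) v = actionDist δ (expUpdate η (𝐩 I t v) (𝐋 I t v)) := by
  have hweight : weight D d η δ ℓ I (t + 1) v = expUpdate η (𝐩 I t v) (𝐋 I t v) :=
    funext fun i => weight_succ D d η δ ℓ I t v i
  rw [← hweight]
  rfl

theorem lossEst_add_delay (s : ℕ) (v : V) (i : A) :
    𝐋 I (s + d v) v i = ℓ s i / observeProb D (𝐩 I s) v i * observed D (I s) v i := by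
  rw [lossEst, if_pos (Nat.le_add_left _ _), Nat.add_sub_cancel]

theorem lossEst_of_lt {t : ℕ} (ht : t < d v) : 𝐋 I t v = 0 :=
  funext fun _ => if_neg (not_le.2 ht)

theorem dependsOn_prob (t : ℕ) : DependsOn (fun I => 𝐩 I t) (Set.Iio t) := fun I J h => by
  funext v i
  simp only [prob]
  rw [weight_congr D d η δ ℓ I J t h]

theorem dependsOn_lossEst_add_delay (s : ℕ) (v : V) :
    DependsOn (fun I => 𝐋 I (s + d v) v) (Set.Iio (s + 1)) := fun I J h => by
  have hprob : 𝐩 I s = 𝐩 J s := dependsOn_prob s fun r hr => h r (Nat.lt_succ_of_lt hr)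
  funext i
  simp only [lossEst_add_delay, hprob, h s (Nat.lt_succ_self s)]

/- The distribution used in round `t` only involves loss estimates of rounds `< t`, hence actions
that are more than `d v` rounds old. -/
theorem dependsOn_prob_delayed (t : ℕ) (v : V) :
    DependsOn (fun I => 𝐩 I t v) (Set.Iio (t - d v)) := by
  induction t with
  | zero => exact fun I J _ => congrFun (dependsOn_prob 0 (by simp)) v
  | succ t ih =>
    intro I J h
    have hprob : 𝐩 I t v = 𝐩 J t v :=
      ih fun r (hr : r < t - d v) => h r (show r < t + 1 - d v by omega)
    have hloss : 𝐋 I t v = 𝐋 J t v := by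
      rcases lt_or_ge t (d v) with ht | ht
      · rw [lossEst_of_lt ht, lossEst_of_lt ht]
      · obtain ⟨s, rfl⟩ := Nat.exists_eq_add_of_le' ht
        exact dependsOn_lossEst_add_delay s v fun r (hr : r < s + 1) =>
          h r (show r < s + d v + 1 - d v by omega)
    simp only [prob_succ, hprob, hloss]

theorem dependsOn_prob_add_delay (s : ℕ) (v : V) :
    DependsOn (fun I => 𝐩 I (s + d v) v) (Set.Iio s) := by
  simpa only [Nat.add_sub_cancel] using
    dependsOn_prob_delayed (D := D) (d := d) (η := η) (δ := δ) (ℓ := ℓ) (s + d v) v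

variable [Nonempty A]

theorem prob_zero (hδ : 0 < δ) (v : V) (i : A) : 𝐩 I 0 v i = 1 / Fintype.card A := by
  have hconst (j : A) : 𝐩 I 0 v j = 𝐩 I 0 v i := by
    simp only [prob, actionDist, truncated, weight_zero]
  have hsum := sum_prob D d η hδ ℓ I 0 v
  rw [Finset.sum_congr rfl fun j _ => hconst j, Finset.sum_const, Finset.card_univ,
    nsmul_eq_mul] at hsum
  exact eq_one_div_of_mul_eq_one_right hsum

theorem prob_nonneg (hδ : 0 < δ) (t : ℕ) (v : V) : 0 ≤ 𝐩 I t v :=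
  fun i => (prob_pos D d η hδ ℓ I t v i).le

theorem prob_le_one (hδ : 0 < δ) (t : ℕ) (v : V) (i : A) : 𝐩 I t v i ≤ 1 :=
  sum_prob D d η hδ ℓ I t v ▸
    Finset.single_le_sum (fun j _ => prob_nonneg hδ t v j) (Finset.mem_univ i)

theorem le_prob (hδ : 0 < δ) (t : ℕ) (v : V) (i : A) :
    δ / Fintype.card A / (1 + δ) ≤ 𝐩 I t v i := by
  refine div_le_actionDist_of_le_truncated hδ (fun j => ?_) (le_max_right _ _)
  cases t with
  | zero => exact (weight_zero D d η δ ℓ I v j).symm ▸ one_pos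
  | succ t => exact (weight_succ D d η δ ℓ I t v j).symm ▸
      expUpdate_pos (prob_pos D d η hδ ℓ I t v j)

theorem prob_dotProduct_le_one {f : A → ℝ} (hδ : 0 < δ) (hf1 : f ≤ 1) (I : ℕ → V → A) (t : ℕ)
    (v : V) : 𝐩 I t v ⬝ᵥ f ≤ 1 := by
  rw [← sum_prob D d η hδ ℓ I t v]
  exact Finset.sum_le_sum fun i _ => mul_le_of_le_one_right (prob_nonneg hδ t v i) (hf1 i)

theorem observeProb_prob_nonneg (hδ : 0 < δ) (t : ℕ) (v : V) (i : A) :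
    0 ≤ observeProb D (𝐩 I t) v i :=
  sub_nonneg.2 (Finset.prod_le_one (fun u _ => sub_nonneg.2 (prob_le_one hδ t u i))
    fun u _ => sub_le_self 1 (prob_nonneg hδ t u i))

theorem prob_le_observeProb (hD : D.Adj v v) (hδ : 0 < δ) (t : ℕ) (i : A) :
    𝐩 I t v i ≤ observeProb D (𝐩 I t) v i :=
  le_observeProb hD (prob_nonneg hδ t) (prob_le_one hδ t)

theorem observeProb_prob_pos (hD : D.Adj v v) (hδ : 0 < δ) (t : ℕ) (i : A) :
    0 < observeProb D (𝐩 I t) v i :=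
  (prob_pos D d η hδ ℓ I t v i).trans_le (prob_le_observeProb hD hδ t i)

theorem varianceProxy_prob_nonneg (hδ : 0 < δ) (I : ℕ → V → A) (t : ℕ) :
    0 ≤ varianceProxy D (𝐩 I t) v :=
  Finset.sum_nonneg fun i _ => div_nonneg (prob_nonneg hδ t v i) (observeProb_prob_nonneg hδ t v i)

theorem sum_varianceProxy_prob_le [Nonempty V] (hD : ∀ v, D.Adj v v) (hδ : 0 < δ)
    (hδ1 : δ ≤ 1) (I : ℕ → V → A) (t : ℕ) :
    ∑ v, varianceProxy D (𝐩 I t) v ≤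
      Fintype.card V + Fintype.card A * (2 * digraphIndepNum D *
        (1 + Real.log (2 * Fintype.card V * Fintype.card A / δ))) := by
  have : (0 : ℝ) < Fintype.card A := Nat.cast_pos.2 Fintype.card_pos
  have hε (v : V) (i : A) : δ / (2 * Fintype.card A) ≤ 𝐩 I t v i := by
    refine le_trans ?_ (le_prob hδ t v i)
    rw [div_div, mul_comm 2]
    gcongr
    linarith
  have hratio : (Fintype.card V : ℝ) / (δ / (2 * Fintype.card A)) =
      2 * Fintype.card V * Fintype.card A / δ := by
    rw [div_div_eq_mul_div]
    ring
  rw [← hratio]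
  exact sum_varianceProxy_le hD (by positivity) hε fun v => sum_prob D d η hδ ℓ I t v

theorem lossEst_nonneg (hδ : 0 < δ) (hℓ0 : 0 ≤ ℓ) (t : ℕ) (v : V) : 0 ≤ 𝐋 I t v := fun i => by
  unfold lossEst
  split_ifs
  · exact mul_nonneg (div_nonneg (hℓ0 _ i) (observeProb_prob_nonneg hδ _ v i))
      (observed_nonneg _ v i)
  · exact le_rfl

/- Summed over the rounds, the logarithms of `mul_dotProduct_sub_le_log_actionDist` telescope. -/
theorem sum_prob_dotProduct_lossEst_le (hη : 0 ≤ η) (hδ : 0 < δ) (hℓ0 : 0 ≤ ℓ) (T : ℕ) (v : V)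
    (k : A) :
    η * ∑ t ∈ Finset.range T, 𝐩 I t v ⬝ᵥ 𝐋 I t v ≤
      Real.log (Fintype.card A) + η * ∑ t ∈ Finset.range T, 𝐋 I t v k + T * δ +
        η ^ 2 * ∑ t ∈ Finset.range T, 𝐩 I t v ⬝ᵥ 𝐋 I t v ^ 2 := by
  have htelescope : η * ∑ t ∈ Finset.range T, 𝐩 I t v ⬝ᵥ 𝐋 I t v ≤
      Real.log (𝐩 I T v k) + Real.log (Fintype.card A) +
        η * ∑ t ∈ Finset.range T, 𝐋 I t v k + T * δ +
        η ^ 2 * ∑ t ∈ Finset.range T, 𝐩 I t v ⬝ᵥ 𝐋 I t v ^ 2 := by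
    induction T with
    | zero => simp [prob_zero hδ]
    | succ T ih =>
      have hstep := mul_dotProduct_sub_le_log_actionDist (L := 𝐋 I T v) hδ hη
        (prob_pos D d η hδ ℓ I T v) (sum_prob D d η hδ ℓ I T v) (lossEst_nonneg hδ hℓ0 T v) k
      rw [← prob_succ] at hstep
      simp only [Finset.sum_range_succ, Nat.cast_add_one]
      linarith
  linarith [Real.log_nonpos (x := 𝐩 I T v k) (prob_nonneg hδ T v k) (prob_le_one hδ T v k)]

theorem prob_dotProduct_le_add_drift {f : A → ℝ} (hη : 0 ≤ η) (hδ : 0 < δ) (hℓ0 : 0 ≤ ℓ)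
    (hf0 : 0 ≤ f) (hf1 : f ≤ 1) (s n : ℕ) (v : V) :
    𝐩 I s v ⬝ᵥ f ≤ 𝐩 I (s + n) v ⬝ᵥ f +
      ∑ m ∈ Finset.range n, (δ + η * (𝐩 I (s + m) v ⬝ᵥ 𝐋 I (s + m) v)) := by
  induction n with
  | zero => simp
  | succ n ih =>
    have hstep := dotProduct_le_actionDist_expUpdate_dotProduct_add (L := 𝐋 I (s + n) v) hδ hη
      (prob_pos D d η hδ ℓ I (s + n) v) (sum_prob D d η hδ ℓ I (s + n) v)
      (lossEst_nonneg hδ hℓ0 (s + n) v) hf0 hf1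
    rw [← prob_succ, add_assoc] at hstep
    rw [Finset.sum_range_succ]
    linarith

theorem le_two_mul_of_forall_one_sub_mul_succ_le {x : ℕ → ℝ} {n : ℕ} (hx : 0 ≤ x n) (hρ1 : ρ ≤ 1)
    (hnρ : 2 * n * ρ ≤ 1) (hstep : ∀ m < n, (1 - ρ) * x (m + 1) ≤ x m) : x n ≤ 2 * x 0 := by
  have hpow (m : ℕ) (hm : m ≤ n) : (1 - ρ) ^ m * x m ≤ x 0 := by
    induction m with
    | zero => simp
    | succ m ih =>
      rw [pow_succ, mul_assoc]
      exact (mul_le_mul_of_nonneg_left (hstep m (by omega)) (pow_nonneg (by linarith) m)).trans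
        (ih (by omega))
  have hbernoulli : 1 / 2 ≤ (1 - ρ) ^ n := by
    have := one_add_mul_le_pow (by linarith : -2 ≤ -ρ) n
    rw [← sub_eq_add_neg] at this
    linarith
  linarith [hpow n le_rfl, mul_le_mul_of_nonneg_right hbernoulli hx]

theorem prob_mul_lossEst_add_delay_le_two (hD : D.Adj v v) (hδ : 0 < δ) (hℓ0 : 0 ≤ ℓ)
    (hℓ1 : ℓ ≤ 1) {s : ℕ} (hstable : 𝐩 I (s + d v) v i ≤ 2 * 𝐩 I s v i) :
    𝐩 I (s + d v) v i * 𝐋 I (s + d v) v i ≤ 2 := by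
  have hq : 0 < observeProb D (𝐩 I s) v i := observeProb_prob_pos hD hδ s i
  have hest : 𝐋 I (s + d v) v i ≤ 1 / observeProb D (𝐩 I s) v i := by
    rw [lossEst_add_delay]
    exact (mul_le_of_le_one_right (div_nonneg (hℓ0 s i) hq.le) (observed_le_one _ v i)).trans
      (div_le_div_of_nonneg_right (hℓ1 s i) hq.le)
  refine (mul_le_mul_of_nonneg_left hest (prob_nonneg hδ _ v i)).trans ?_
  rw [mul_one_div, div_le_iff₀ hq]
  linarith [prob_le_observeProb (I := I) (d := d) (η := η) (ℓ := ℓ) hD hδ s i]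

/- By strong induction: stability before round `t` bounds the estimates used in round `t`, and
these control the change of the distribution in round `t`. -/
theorem one_sub_mul_prob_succ_le (hD : D.Adj v v) (hη : 0 ≤ η) (hδ : 0 < δ) (hℓ0 : 0 ≤ ℓ)
    (hℓ1 : ℓ ≤ 1) (hδρ : δ ≤ ρ) (hρ1 : ρ ≤ 1) (hdρ : 2 * d v * ρ ≤ 1)
    (hηρ : η * (Fintype.card A * 2) ≤ ρ) (t : ℕ) (i : A) :
    (1 - ρ) * 𝐩 I (t + 1) v i ≤ 𝐩 I t v i := by
  induction t using Nat.strong_induction_on generalizing i with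
  | _ t ih =>
    have hterm (j : A) : 𝐩 I t v j * 𝐋 I t v j ≤ 2 := by
      rcases lt_or_ge t (d v) with ht | ht
      · simp [lossEst_of_lt ht]
      · obtain ⟨s, rfl⟩ := Nat.exists_eq_add_of_le' ht
        exact prob_mul_lossEst_add_delay_le_two hD hδ hℓ0 hℓ1
          (le_two_mul_of_forall_one_sub_mul_succ_le (x := fun m => 𝐩 I (s + m) v j)
            (prob_nonneg hδ _ v j) hρ1 hdρ fun m hm => ih (s + m) (by omega) j)
    have hestimates : 𝐩 I t v ⬝ᵥ 𝐋 I t v ≤ Fintype.card A * 2 :=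
      (Finset.sum_le_card_nsmul _ _ 2 fun j _ => hterm j).trans_eq (nsmul_eq_mul _ _)
    rw [prob_succ]
    exact mul_actionDist_expUpdate_le hδ hη (prob_pos D d η hδ ℓ I t v)
      (sum_prob D d η hδ ℓ I t v) (lossEst_nonneg hδ hℓ0 t v) (le_prob hδ t v i) hδρ hρ1
      ((mul_le_mul_of_nonneg_left hestimates hη).trans hηρ)

theorem prob_add_delay_le_two_mul (hD : D.Adj v v) (hη : 0 ≤ η) (hδ : 0 < δ) (hℓ0 : 0 ≤ ℓ)
    (hℓ1 : ℓ ≤ 1) (hδρ : δ ≤ ρ) (hρ1 : ρ ≤ 1) (hdρ : 2 * d v * ρ ≤ 1)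
    (hηρ : η * (Fintype.card A * 2) ≤ ρ) (s : ℕ) (i : A) :
    𝐩 I (s + d v) v i ≤ 2 * 𝐩 I s v i :=
  le_two_mul_of_forall_one_sub_mul_succ_le (x := fun m => 𝐩 I (s + m) v i)
    (prob_nonneg hδ _ v i) hρ1 hdρ fun m _ =>
      one_sub_mul_prob_succ_le hD hη hδ hℓ0 hℓ1 hδρ hρ1 hdρ hηρ (s + m) i

theorem extend_snoc {V A : Type*} [Nonempty A] {T : ℕ} (a : Fin T → V → A) (x : V → A) :
    extend (Fin.snoc (α := fun _ => V → A) a x) = Function.update (extend a) T x := by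
  funext t v
  rcases lt_trichotomy t T with h | rfl | h
  · simp [extend, h, Nat.lt_succ_of_lt h, Fin.snoc, h.ne]
  · simp [extend, Fin.snoc]
  · simp [extend, h.ne', not_lt.2 h.le, show ¬ t < T + 1 by omega]

theorem trajProb_snoc {T : ℕ} (a : Fin T → V → A) (x : V → A) :
    trajProb D d η δ ℓ (T + 1) (Fin.snoc (α := fun _ => V → A) a x) =
      trajProb D d η δ ℓ T a * ∏ v, 𝐩 (extend a) T v (x v) := by
  have hprob (t : ℕ) (ht : t ≤ T) : 𝐩 (Function.update (extend a) T x) t = 𝐩 (extend a) t :=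
    dependsOn_prob t fun r (hr : r < t) => Function.update_of_ne (hr.trans_le ht).ne _ _
  simp only [trajProb, Fin.prod_univ_castSucc, extend_snoc, Fin.val_castSucc, Fin.val_last,
    Fin.snoc_castSucc, Fin.snoc_last, hprob T le_rfl, hprob _ Fin.is_le']

end Path

section IndependentDraws

variable {V A : Type*} [Fintype V] [DecidableEq V] [Fintype A]

/-- Expectation of `h x` when the agents `v` draw their actions `x v` independently of each other,
agent `v` from the distribution `p v`. -/
noncomputable def drawExpect (p : V → A → ℝ) (h : (V → A) → ℝ) : ℝ :=
  ∑ x, (∏ v, p v (x v)) * h x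

variable {p : V → A → ℝ}

theorem drawExpect_prod (hp : ∀ v, ∑ i, p v i = 1) (s : Finset V) (f : V → A → ℝ) :
    drawExpect p (fun x => ∏ u ∈ s, f u (x u)) = ∏ u ∈ s, p u ⬝ᵥ f u := by
  calc drawExpect p (fun x => ∏ u ∈ s, f u (x u))
      = ∑ x : V → A, ∏ u, p u (x u) * (if u ∈ s then f u (x u) else 1) := by
        simp only [drawExpect, Finset.prod_mul_distrib, Finset.prod_ite_mem, Finset.univ_inter]
    _ = ∏ u, ∑ i, p u i * (if u ∈ s then f u i else 1) :=
        (Fintype.prod_sum fun u i => p u i * if u ∈ s then f u i else 1).symm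
    _ = ∏ u, if u ∈ s then p u ⬝ᵥ f u else 1 :=
        Finset.prod_congr rfl fun u _ => by split_ifs <;> simp [dotProduct, hp]
    _ = ∏ u ∈ s, p u ⬝ᵥ f u := by rw [Finset.prod_ite_mem, Finset.univ_inter]

theorem drawExpect_const (hp : ∀ v, ∑ i, p v i = 1) (c : ℝ) : drawExpect p (fun _ => c) = c := by
  have hone : drawExpect p (fun _ => 1) = 1 := drawExpect_prod hp ∅ 0
  simp only [drawExpect, ← Finset.sum_mul, mul_one] at hone ⊢
  rw [hone, one_mul]

theorem drawExpect_apply (hp : ∀ v, ∑ i, p v i = 1) (v : V) (f : A → ℝ) :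
    drawExpect p (fun x => f (x v)) = p v ⬝ᵥ f := by
  simpa only [Finset.prod_singleton] using drawExpect_prod hp {v} fun _ => f

open scoped Classical in
theorem observed_eq_one_sub_prod {V A : Type*} [Fintype V] (D : Digraph V) (x : V → A) (v : V)
    (i : A) : observed D x v i = 1 - ∏ u ∈ inNeighbors D v, if x u = i then 0 else 1 := by
  simp only [observed, ← ite_not (_ = i), Finset.prod_ite_zero, Finset.prod_const_one]
  split_ifs <;> grind

theorem drawExpect_observed (D : Digraph V) (hp : ∀ v, ∑ i, p v i = 1) (v : V) (i : A) :
    drawExpect p (fun x => observed D x v i) = observeProb D p v i := by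
  classical
  have hmissed (u : V) : (p u ⬝ᵥ fun j => if j = i then 0 else 1) = 1 - p u i := by
    simp only [dotProduct, mul_ite, mul_zero, mul_one]
    rw [← hp u, eq_sub_iff_add_eq, Finset.sum_ite, Finset.sum_const_zero, zero_add, add_comm,
      Finset.filter_ne', Finset.add_sum_erase _ _ (Finset.mem_univ i)]
  simp only [observed_eq_one_sub_prod]
  calc drawExpect p (fun x => 1 - ∏ u ∈ inNeighbors D v, if x u = i then 0 else 1)
      = drawExpect p (fun _ => 1) -
          drawExpect p (fun x => ∏ u ∈ inNeighbors D v, if x u = i then 0 else 1) := by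
        simp only [drawExpect, mul_sub, Finset.sum_sub_distrib]
    _ = observeProb D p v i := by
        rw [drawExpect_const hp, drawExpect_prod hp _ fun _ j => if j = i then 0 else 1]
        simp only [hmissed, observeProb]

end IndependentDraws

section Expectation

variable {V A : Type*} [Fintype V] [DecidableEq V] [Fintype A] [Nonempty A] {D : Digraph V}
  {d : V → ℕ} {η δ : ℝ} {ℓ : ℕ → A → ℝ} {s T : ℕ} {v : V} {F G g : (ℕ → V → A) → ℝ}

/-- `expect` for functions of a whole path of actions, of which the rounds `0, …, T - 1` are drawn
and the later ones are arbitrary: functions of different numbers of rounds thus have the same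
type. -/
noncomputable def pathExpect {V A : Type*} [Fintype V] [DecidableEq V] [Fintype A] [Nonempty A]
    (D : Digraph V) (d : V → ℕ) (η δ : ℝ) (ℓ : ℕ → A → ℝ) (T : ℕ) (F : (ℕ → V → A) → ℝ) : ℝ :=
  expect D d η δ ℓ T fun a => F (extend a)

local notation "𝐩" => prob D d η δ ℓ
local notation "𝐋" => lossEst D d η δ ℓ
local notation "𝐄" => pathExpect D d η δ ℓ

theorem pathExpect_add (F G : (ℕ → V → A) → ℝ) :
    𝐄 T (fun I => F I + G I) = 𝐄 T F + 𝐄 T G := by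
  simp only [pathExpect, expect, mul_add, Finset.sum_add_distrib]

theorem pathExpect_const_mul (c : ℝ) (F : (ℕ → V → A) → ℝ) :
    𝐄 T (fun I => c * F I) = c * 𝐄 T F := by
  simp only [pathExpect, expect, Finset.mul_sum, mul_left_comm]

theorem pathExpect_sum {ι : Type*} (r : Finset ι) (F : ι → (ℕ → V → A) → ℝ) :
    𝐄 T (fun I => ∑ j ∈ r, F j I) = ∑ j ∈ r, 𝐄 T (F j) := by
  simp only [pathExpect, expect, Finset.mul_sum]
  exact Finset.sum_comm

theorem pathExpect_const (hδ : 0 < δ) (c : ℝ) : 𝐄 T (fun _ => c) = c := by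
  rw [pathExpect, expect, ← Finset.sum_mul, sum_trajProb D d η hδ, one_mul]

theorem pathExpect_mono (hδ : 0 < δ) (h : ∀ I, F I ≤ G I) : 𝐄 T F ≤ 𝐄 T G :=
  Finset.sum_le_sum fun a _ => mul_le_mul_of_nonneg_left (h _) (trajProb_nonneg D d η hδ ℓ T a)

theorem pathExpect_succ (F : (ℕ → V → A) → ℝ) :
    𝐄 (T + 1) F = 𝐄 T fun I => drawExpect (𝐩 I T) fun x => F (Function.update I T x) := by
  simp only [pathExpect, expect, drawExpect]
  rw [← (Fin.snocEquiv (fun _ : Fin (T + 1) => V → A)).sum_comp, Fintype.sum_prod_type_right]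
  refine Finset.sum_congr rfl fun a _ => ?_
  rw [Finset.mul_sum]
  refine Finset.sum_congr rfl fun x _ => ?_
  change trajProb D d η δ ℓ (T + 1) (Fin.snoc (α := fun _ => V → A) a x) *
    F (extend (Fin.snoc (α := fun _ => V → A) a x)) = _
  rw [trajProb_snoc, extend_snoc, mul_assoc]

theorem pathExpect_eq_of_dependsOn (hδ : 0 < δ) (hF : DependsOn F (Set.Iio s)) (hs : s ≤ T) :
    𝐄 T F = 𝐄 s F := by
  induction T, hs using Nat.le_induction with
  | base => rfl
  | succ T hT ih =>
    have hF' (I : ℕ → V → A) (x : V → A) : F (Function.update I T x) = F I :=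
      hF fun r (hr : r < s) => Function.update_of_ne (hr.trans_le hT).ne _ _
    simp only [pathExpect_succ, ← ih, hF', drawExpect_const (sum_prob D d η hδ ℓ _ T)]

theorem pathExpect_mul_apply (hδ : 0 < δ) (hg : DependsOn g (Set.Iio s)) (hs : s < T)
    (h : (V → A) → ℝ) :
    𝐄 T (fun I => g I * h (I s)) = 𝐄 T fun I => g I * drawExpect (𝐩 I s) h := by
  have hleft : DependsOn (fun I => g I * h (I s)) (Set.Iio (s + 1)) := fun I J hIJ => by
    simp only [hg fun r (hr : r < s) => hIJ r (Nat.lt_succ_of_lt hr), hIJ s (Nat.lt_succ_self s)]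
  have hright : DependsOn (fun I => g I * drawExpect (𝐩 I s) h) (Set.Iio s) := fun I J hIJ => by
    have hprob : 𝐩 I s = 𝐩 J s := dependsOn_prob s hIJ
    simp only [hg hIJ, hprob]
  have hg' (I : ℕ → V → A) (x : V → A) : g (Function.update I s x) = g I :=
    hg fun r (hr : r < s) => Function.update_of_ne hr.ne _ _
  rw [pathExpect_eq_of_dependsOn hδ hleft hs, pathExpect_eq_of_dependsOn hδ hright hs.le,
    pathExpect_succ]
  simp only [hg', Function.update_self, drawExpect, Finset.mul_sum, mul_left_comm]

theorem pathExpect_apply (hδ : 0 < δ) (hs : s < T) (v : V) (f : A → ℝ) :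
    𝐄 T (fun I => f (I s v)) = 𝐄 T fun I => 𝐩 I s v ⬝ᵥ f := by
  simpa only [one_mul, drawExpect_apply (sum_prob D d η hδ ℓ _ s)] using
    pathExpect_mul_apply (D := D) (d := d) (η := η) (ℓ := ℓ) (g := fun _ => 1) hδ
      (fun _ _ _ => rfl) hs fun x => f (x v)

theorem pathExpect_mul_observed (hδ : 0 < δ) (hg : DependsOn g (Set.Iio s)) (hs : s < T) (v : V)
    (i : A) :
    𝐄 T (fun I => g I * observed D (I s) v i) = 𝐄 T fun I => g I * observeProb D (𝐩 I s) v i := by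
  simpa only [drawExpect_observed D (sum_prob D d η hδ ℓ _ s)] using
    pathExpect_mul_apply (D := D) (d := d) (η := η) (ℓ := ℓ) hδ hg hs fun x => observed D x v i

theorem pathExpect_mul_lossEst (hD : D.Adj v v) (hδ : 0 < δ) (hg : DependsOn g (Set.Iio s))
    (hs : s < T) (i : A) :
    𝐄 T (fun I => g I * 𝐋 I (s + d v) v i) = 𝐄 T fun I => g I * ℓ s i := by
  have hg' : DependsOn (fun I => g I * (ℓ s i / observeProb D (𝐩 I s) v i)) (Set.Iio s) :=
    fun I J h => by
      have hprob : 𝐩 I s = 𝐩 J s := dependsOn_prob s h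
      simp only [hg h, hprob]
  simp only [lossEst_add_delay, ← mul_assoc]
  rw [pathExpect_mul_observed hδ hg' hs]
  simp only [mul_assoc, div_mul_cancel₀ _ (observeProb_prob_pos hD hδ s i).ne']

theorem pathExpect_mul_lossEst_sq (hD : D.Adj v v) (hδ : 0 < δ) (hg : DependsOn g (Set.Iio s))
    (hs : s < T) (i : A) :
    𝐄 T (fun I => g I * 𝐋 I (s + d v) v i ^ 2) =
      𝐄 T fun I => g I * (ℓ s i ^ 2 / observeProb D (𝐩 I s) v i) := by
  have hg' : DependsOn (fun I => g I * (ℓ s i / observeProb D (𝐩 I s) v i) ^ 2) (Set.Iio s) :=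
    fun I J h => by
      have hprob : 𝐩 I s = 𝐩 J s := dependsOn_prob s h
      simp only [hg h, hprob]
  have hsq (x : V → A) : observed D x v i ^ 2 = observed D x v i := by
    unfold observed; split_ifs <;> norm_num
  simp only [lossEst_add_delay, mul_pow, hsq, ← mul_assoc]
  rw [pathExpect_mul_observed hδ hg' hs]
  congr 1 with I
  have := (observeProb_prob_pos (d := d) (η := η) (ℓ := ℓ) (I := I) hD hδ s i).ne'
  field_simp

end Expectation

section Regret

theorem sum_range_le_sum_range_add_of_delay {f g : ℕ → ℝ} {n T : ℕ} {c : ℝ} (hn : n ≤ T)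
    (hc : 0 ≤ c) (hf : ∀ s < T, f s ≤ 1) (hg : ∀ t < n, 0 ≤ g t)
    (h : ∀ s, s + n < T → f s ≤ g (s + n) + c) :
    ∑ s ∈ Finset.range T, f s ≤ ∑ t ∈ Finset.range T, g t + T * c + n := by
  obtain ⟨m, rfl⟩ := Nat.exists_eq_add_of_le' hn
  have hearly : ∑ s ∈ Finset.range m, f s ≤ ∑ s ∈ Finset.range m, g (s + n) + m * c := by
    refine (Finset.sum_le_sum fun s hs =>
      h s (Nat.add_lt_add_right (Finset.mem_range.1 hs) n)).trans_eq ?_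
    rw [Finset.sum_add_distrib, Finset.sum_const, Finset.card_range, nsmul_eq_mul]
  have hlate : ∑ j ∈ Finset.range n, f (m + j) ≤ n := by
    refine (Finset.sum_le_card_nsmul _ _ 1 fun j hj =>
      hf _ (Nat.add_lt_add_left (Finset.mem_range.1 hj) m)).trans_eq ?_
    rw [Finset.card_range, nsmul_one]
  have hshift : ∑ s ∈ Finset.range m, g (s + n) ≤ ∑ t ∈ Finset.range (m + n), g t := by
    rw [add_comm m n, Finset.sum_range_add]
    simp only [add_comm n]
    exact le_add_of_nonneg_left (Finset.sum_nonneg fun t ht => hg t (Finset.mem_range.1 ht))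
  rw [Finset.sum_range_add, Nat.cast_add, add_mul]
  linarith [mul_nonneg n.cast_nonneg hc]

theorem sum_range_le_sum_range_of_delay {f g : ℕ → ℝ} {n T : ℕ} (hn : n ≤ T)
    (hf : ∀ s < T, 0 ≤ f s) (hg : ∀ t < n, g t = 0) (h : ∀ s < T, g (s + n) ≤ f s) :
    ∑ t ∈ Finset.range T, g t ≤ ∑ s ∈ Finset.range T, f s := by
  obtain ⟨m, rfl⟩ := Nat.exists_eq_add_of_le hn
  rw [Finset.sum_range_add, Finset.sum_eq_zero fun t ht => hg t (Finset.mem_range.1 ht), zero_add]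
  have hsub : m ≤ n + m := Nat.le_add_left m n
  calc ∑ s ∈ Finset.range m, g (n + s)
      ≤ ∑ s ∈ Finset.range m, f s := Finset.sum_le_sum fun s hs =>
        add_comm s n ▸ h s ((Finset.mem_range.1 hs).trans_le hsub)
    _ ≤ ∑ s ∈ Finset.range (n + m), f s :=
        Finset.sum_le_sum_of_subset_of_nonneg (Finset.range_mono hsub)
          fun s hs _ => hf s (Finset.mem_range.1 hs)

variable {V A : Type*} [Fintype V] [DecidableEq V] [Fintype A] [Nonempty A] {D : Digraph V}
  {d : V → ℕ} {η δ : ℝ} {ℓ : ℕ → A → ℝ} {s T : ℕ} {v : V}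

local notation "𝐩" => prob D d η δ ℓ
local notation "𝐋" => lossEst D d η δ ℓ
local notation "𝐄" => pathExpect D d η δ ℓ

theorem pathExpect_lossEst (hD : D.Adj v v) (hδ : 0 < δ) (hs : s < T) (i : A) :
    𝐄 T (fun I => 𝐋 I (s + d v) v i) = ℓ s i := by
  simpa only [one_mul, pathExpect_const hδ] using pathExpect_mul_lossEst (D := D) (d := d)
    (η := η) (ℓ := ℓ) (g := fun _ => 1) hD hδ (fun _ _ _ => rfl) hs i

theorem pathExpect_prob_dotProduct_lossEst (hD : D.Adj v v) (hδ : 0 < δ) (hs : s < T) :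
    𝐄 T (fun I => 𝐩 I (s + d v) v ⬝ᵥ 𝐋 I (s + d v) v) =
      𝐄 T fun I => 𝐩 I (s + d v) v ⬝ᵥ ℓ s := by
  simp only [dotProduct, pathExpect_sum]
  exact Finset.sum_congr rfl fun i _ => pathExpect_mul_lossEst hD hδ
    (fun I J h => congrFun (dependsOn_prob_add_delay s v h) i) hs i

theorem pathExpect_prob_dotProduct_lossEst_le_one (hD : D.Adj v v) (hδ : 0 < δ) (hℓ1 : ℓ ≤ 1)
    {t : ℕ} (ht : t < T) : 𝐄 T (fun I => 𝐩 I t v ⬝ᵥ 𝐋 I t v) ≤ 1 := by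
  rcases lt_or_ge t (d v) with htd | htd
  · simp only [lossEst_of_lt htd, dotProduct_zero, pathExpect_const hδ, zero_le_one]
  · obtain ⟨s, rfl⟩ := Nat.exists_eq_add_of_le' htd
    rw [pathExpect_prob_dotProduct_lossEst hD hδ (le_self_add.trans_lt ht)]
    exact (pathExpect_mono hδ fun I => prob_dotProduct_le_one hδ (hℓ1 s) I _ v).trans_eq
      (pathExpect_const hδ 1)

theorem pathExpect_prob_dotProduct_loss_le (hD : D.Adj v v) (hη : 0 ≤ η) (hδ : 0 < δ)
    (hℓ0 : 0 ≤ ℓ) (hℓ1 : ℓ ≤ 1) (hs : s + d v < T) :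
    𝐄 T (fun I => 𝐩 I s v ⬝ᵥ ℓ s) ≤
      𝐄 T (fun I => 𝐩 I (s + d v) v ⬝ᵥ 𝐋 I (s + d v) v) + d v * (δ + η) := by
  refine (pathExpect_mono hδ fun I =>
    prob_dotProduct_le_add_drift hη hδ hℓ0 (hℓ0 s) (hℓ1 s) s (d v) v).trans ?_
  rw [pathExpect_add, ← pathExpect_prob_dotProduct_lossEst hD hδ (le_self_add.trans_lt hs),
    pathExpect_sum]
  gcongr
  refine (Finset.sum_le_card_nsmul _ _ (δ + η) fun m hm => ?_).trans_eq
    (by rw [Finset.card_range, nsmul_eq_mul])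
  rw [pathExpect_add, pathExpect_const_mul, pathExpect_const hδ]
  gcongr
  exact mul_le_of_le_one_right hη (pathExpect_prob_dotProduct_lossEst_le_one hD hδ hℓ1
    ((Nat.add_lt_add_left (Finset.mem_range.1 hm) s).trans hs))

/- The last `d v` rounds, whose losses are not estimated within the horizon, cost at most `1`
each. -/
theorem sum_pathExpect_prob_dotProduct_loss_le (hD : D.Adj v v) (hη : 0 ≤ η) (hδ : 0 < δ)
    (hℓ0 : 0 ≤ ℓ) (hℓ1 : ℓ ≤ 1) (hv : d v ≤ T) :
    ∑ t ∈ Finset.range T, 𝐄 T (fun I => 𝐩 I t v ⬝ᵥ ℓ t) ≤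
      ∑ t ∈ Finset.range T, 𝐄 T (fun I => 𝐩 I t v ⬝ᵥ 𝐋 I t v) + T * (d v * (δ + η)) + d v :=
  sum_range_le_sum_range_add_of_delay hv (by positivity)
    (fun s _ => (pathExpect_mono hδ fun I => prob_dotProduct_le_one hδ (hℓ1 s) I s v).trans_eq
      (pathExpect_const hδ 1))
    (fun t ht => by simp only [lossEst_of_lt ht, dotProduct_zero, pathExpect_const hδ, le_rfl])
    fun s hs => pathExpect_prob_dotProduct_loss_le hD hη hδ hℓ0 hℓ1 hs

theorem sum_pathExpect_lossEst_le (hD : D.Adj v v) (hδ : 0 < δ) (hℓ0 : 0 ≤ ℓ) (hv : d v ≤ T)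
    (k : A) :
    ∑ t ∈ Finset.range T, 𝐄 T (fun I => 𝐋 I t v k) ≤ ∑ t ∈ Finset.range T, ℓ t k :=
  sum_range_le_sum_range_of_delay hv (fun s _ => hℓ0 s k)
    (fun t ht => by simp only [lossEst_of_lt ht, Pi.zero_apply, pathExpect_const hδ])
    fun s hs => (pathExpect_lossEst hD hδ hs k).le

theorem pathExpect_prob_dotProduct_lossEst_sq_le (hD : D.Adj v v) (hδ : 0 < δ) (hℓ0 : 0 ≤ ℓ)
    (hℓ1 : ℓ ≤ 1) (hs : s < T) (hstable : ∀ I i, 𝐩 I (s + d v) v i ≤ 2 * 𝐩 I s v i) :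
    𝐄 T (fun I => 𝐩 I (s + d v) v ⬝ᵥ 𝐋 I (s + d v) v ^ 2) ≤
      2 * 𝐄 T fun I => varianceProxy D (𝐩 I s) v := by
  calc 𝐄 T (fun I => 𝐩 I (s + d v) v ⬝ᵥ 𝐋 I (s + d v) v ^ 2)
      = 𝐄 T fun I => ∑ i, 𝐩 I (s + d v) v i * (ℓ s i ^ 2 / observeProb D (𝐩 I s) v i) := by
        simp only [dotProduct, pathExpect_sum, Pi.pow_apply]
        exact Finset.sum_congr rfl fun i _ => pathExpect_mul_lossEst_sq hD hδ
          (fun I J h => congrFun (dependsOn_prob_add_delay s v h) i) hs i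
    _ ≤ 𝐄 T fun I => 2 * varianceProxy D (𝐩 I s) v := by
        refine pathExpect_mono hδ fun I => ?_
        rw [varianceProxy, Finset.mul_sum]
        refine Finset.sum_le_sum fun i _ => ?_
        rw [mul_div_assoc', mul_div_assoc']
        refine div_le_div_of_nonneg_right ?_ (observeProb_prob_nonneg hδ s v i)
        exact (mul_le_of_le_one_right (prob_nonneg hδ _ v i)
          (pow_le_one₀ (hℓ0 s i) (hℓ1 s i))).trans (hstable I i)
    _ = 2 * 𝐄 T fun I => varianceProxy D (𝐩 I s) v := pathExpect_const_mul 2 _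

theorem sum_pathExpect_prob_dotProduct_lossEst_sq_le (hD : D.Adj v v) (hδ : 0 < δ) (hℓ0 : 0 ≤ ℓ)
    (hℓ1 : ℓ ≤ 1) (hstable : ∀ I s i, 𝐩 I (s + d v) v i ≤ 2 * 𝐩 I s v i) (hv : d v ≤ T) :
    ∑ t ∈ Finset.range T, 𝐄 T (fun I => 𝐩 I t v ⬝ᵥ 𝐋 I t v ^ 2) ≤
      2 * ∑ t ∈ Finset.range T, 𝐄 T fun I => varianceProxy D (𝐩 I t) v := by
  rw [Finset.mul_sum]
  refine sum_range_le_sum_range_of_delay hv (fun s _ => ?_) (fun t ht => ?_) fun s hs =>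
    pathExpect_prob_dotProduct_lossEst_sq_le hD hδ hℓ0 hℓ1 hs (hstable · s)
  · exact mul_nonneg zero_le_two ((pathExpect_const hδ 0).symm.trans_le
      (pathExpect_mono hδ fun I => varianceProxy_prob_nonneg hδ I s))
  · simp only [lossEst_of_lt ht, zero_pow two_ne_zero, dotProduct_zero, pathExpect_const hδ]

theorem sum_pathExpect_prob_dotProduct_lossEst_le (hD : D.Adj v v) (hη : 0 < η) (hδ : 0 < δ)
    (hℓ0 : 0 ≤ ℓ) (hℓ1 : ℓ ≤ 1) (hstable : ∀ I s i, 𝐩 I (s + d v) v i ≤ 2 * 𝐩 I s v i)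
    (hv : d v ≤ T) (k : A) :
    ∑ t ∈ Finset.range T, 𝐄 T (fun I => 𝐩 I t v ⬝ᵥ 𝐋 I t v) ≤
      ∑ t ∈ Finset.range T, ℓ t k + (Real.log (Fintype.card A) + T * δ) / η +
        2 * η * ∑ t ∈ Finset.range T, 𝐄 T fun I => varianceProxy D (𝐩 I t) v := by
  have hweights := pathExpect_mono (D := D) (d := d) (η := η) (ℓ := ℓ) (T := T) hδ fun I =>
    sum_prob_dotProduct_lossEst_le (D := D) (d := d) (I := I) hη.le hδ hℓ0 T v k
  simp only [pathExpect_add, pathExpect_const_mul, pathExpect_sum, pathExpect_const hδ]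
    at hweights
  have hmean := mul_le_mul_of_nonneg_left
    (sum_pathExpect_lossEst_le (D := D) (η := η) hD hδ hℓ0 hv k) hη.le
  have hvariance := mul_le_mul_of_nonneg_left
    (sum_pathExpect_prob_dotProduct_lossEst_sq_le hD hδ hℓ0 hℓ1 hstable hv) (sq_nonneg η)
  refine le_of_mul_le_mul_left ?_ hη
  rw [mul_add, mul_add, mul_div_cancel₀ _ hη.ne']
  linarith

theorem pathExpect_sum_loss_le (hD : D.Adj v v) (hη : 0 < η) (hδ : 0 < δ) (hℓ0 : 0 ≤ ℓ)
    (hℓ1 : ℓ ≤ 1) (hstable : ∀ I s i, 𝐩 I (s + d v) v i ≤ 2 * 𝐩 I s v i) (hv : d v ≤ T) (k : A) :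
    𝐄 T (fun I => ∑ t ∈ Finset.range T, ℓ t (I t v)) ≤
      ∑ t ∈ Finset.range T, ℓ t k + d v * (1 + T * (δ + η)) +
        (Real.log (Fintype.card A) + T * δ) / η +
        2 * η * ∑ t ∈ Finset.range T, 𝐄 T fun I => varianceProxy D (𝐩 I t) v := by
  have hdraw : 𝐄 T (fun I => ∑ t ∈ Finset.range T, ℓ t (I t v)) =
      ∑ t ∈ Finset.range T, 𝐄 T fun I => 𝐩 I t v ⬝ᵥ ℓ t := by
    rw [pathExpect_sum]
    exact Finset.sum_congr rfl fun t ht => pathExpect_apply hδ (Finset.mem_range.1 ht) v (ℓ t)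
  rw [hdraw]
  linarith [sum_pathExpect_prob_dotProduct_loss_le (T := T) hD hη.le hδ hℓ0 hℓ1 hv,
    sum_pathExpect_prob_dotProduct_lossEst_le hD hη hδ hℓ0 hℓ1 hstable hv k]

theorem sum_expect_loss_le [Nonempty V] (hD : ∀ v, D.Adj v v) (hη : 0 < η) (hδ : 0 < δ)
    (hδ1 : δ ≤ 1) (hℓ0 : 0 ≤ ℓ) (hℓ1 : ℓ ≤ 1)
    (hstable : ∀ I s v i, 𝐩 I (s + d v) v i ≤ 2 * 𝐩 I s v i) (hd : ∀ v, d v ≤ T) (k : A) :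
    ∑ v, expect D d η δ ℓ T (fun a => ∑ t : Fin T, ℓ t (a t v)) ≤
      Fintype.card V * ∑ t ∈ Finset.range T, ℓ t k + (∑ v, (d v : ℝ)) * (1 + T * (δ + η)) +
        Fintype.card V * ((Real.log (Fintype.card A) + T * δ) / η) +
        2 * η * (T * (Fintype.card V + Fintype.card A * (2 * digraphIndepNum D *
          (1 + Real.log (2 * Fintype.card V * Fintype.card A / δ))))) := by
  have hpath (v : V) : expect D d η δ ℓ T (fun a => ∑ t : Fin T, ℓ t (a t v)) =
      𝐄 T fun I => ∑ t ∈ Finset.range T, ℓ t (I t v) := by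
    simp only [pathExpect, extend, ← Fin.sum_univ_eq_sum_range, Fin.is_lt, dif_pos]
  have hvariance : ∑ v, ∑ t ∈ Finset.range T, 𝐄 T (fun I => varianceProxy D (𝐩 I t) v) ≤
      T * (Fintype.card V + Fintype.card A * (2 * digraphIndepNum D *
        (1 + Real.log (2 * Fintype.card V * Fintype.card A / δ)))) := by
    rw [Finset.sum_comm]
    refine (Finset.sum_le_card_nsmul _ _ _ fun t _ => ?_).trans_eq
      (by rw [Finset.card_range, nsmul_eq_mul])
    rw [← pathExpect_sum]
    exact (pathExpect_mono hδ fun I => sum_varianceProxy_prob_le hD hδ hδ1 I t).trans_eq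
      (pathExpect_const hδ _)
  simp only [hpath]
  refine (Finset.sum_le_sum fun v _ =>
    pathExpect_sum_loss_le (hD v) hη hδ hℓ0 hℓ1 (hstable · · v) (hd v) k).trans ?_
  simp only [Finset.sum_add_distrib, ← Finset.mul_sum, Finset.sum_const, Finset.card_univ,
    nsmul_eq_mul, ← Finset.sum_mul]
  gcongr

theorem welfareRegret_le [Nonempty V] (hD : ∀ v, D.Adj v v) (hη : 0 < η) (hδ : 0 < δ)
    (hδ1 : δ ≤ 1) (hℓ0 : 0 ≤ ℓ) (hℓ1 : ℓ ≤ 1)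
    (hstable : ∀ I s v i, 𝐩 I (s + d v) v i ≤ 2 * 𝐩 I s v i) (hd : ∀ v, d v ≤ T) :
    welfareRegret D d η δ ℓ T ≤
      avgDelay d * (1 + T * (δ + η)) + (Real.log (Fintype.card A) + T * δ) / η +
        2 * η * T * (1 + 2 * (Fintype.card A / Fintype.card V * digraphIndepNum D) *
          (1 + Real.log (2 * Fintype.card V * Fintype.card A / δ))) := by
  have hV : (Fintype.card V : ℝ) ≠ 0 := Nat.cast_ne_zero.2 Fintype.card_ne_zero
  obtain ⟨k, hk⟩ := exists_eq_ciInf_of_finite (f := fun i : A => ∑ t ∈ Finset.range T, ℓ t i)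
  rw [welfareRegret, ← hk, avgDelay, sub_le_iff_le_add]
  refine (mul_le_mul_of_nonneg_left
    (sum_expect_loss_le hD hη hδ hδ1 hℓ0 hℓ1 hstable hd k) (by positivity)).trans_eq ?_
  field_simp
  ring

theorem welfareRegret_eq_zero [Nonempty V] [Subsingleton A] (hδ : 0 < δ) :
    welfareRegret D d η δ ℓ T = 0 := by
  have hV : (Fintype.card V : ℝ) ≠ 0 := Nat.cast_ne_zero.2 Fintype.card_ne_zero
  have hloss (t : ℕ) (i : A) : ℓ t i = ℓ t (Classical.arbitrary A) :=
    congrArg (ℓ t) (Subsingleton.elim _ _)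
  have hexpect (v : V) : expect D d η δ ℓ T (fun a => ∑ t : Fin T, ℓ t (a t v)) =
      ∑ t ∈ Finset.range T, ℓ t (Classical.arbitrary A) := by
    simp only [hloss _ (_ : A), Fin.sum_univ_eq_sum_range fun t => ℓ t (Classical.arbitrary A)]
    exact pathExpect_const hδ _
  have hmin : ⨅ i : A, ∑ t ∈ Finset.range T, ℓ t i =
      ∑ t ∈ Finset.range T, ℓ t (Classical.arbitrary A) := by
    rw [iInf_congr fun i => Finset.sum_congr rfl fun t _ => hloss t i, ciInf_const]
  rw [welfareRegret, hmin]
  simp only [hexpect, Finset.sum_const, Finset.card_univ, nsmul_eq_mul, one_div,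
    inv_mul_cancel_left₀ hV, sub_self]

end Regret

section MainBound

theorem commDigraph_adj_self {V : Type*} (G : SimpleGraph V) (d ttl : V → ℕ) (v : V) :
    (commDigraph G d ttl).Adj v v := by
  simp only [commDigraph, SimpleGraph.edist_self, zero_le]

theorem avgDelay_nonneg {V : Type*} [Fintype V] (d : V → ℕ) : 0 ≤ avgDelay d := by
  unfold avgDelay
  positivity

theorem avgDelay_le {V : Type*} [Fintype V] [Nonempty V] {d : V → ℕ} {M : ℕ} (hd : ∀ v, d v ≤ M) :
    avgDelay d ≤ M := by
  rw [avgDelay, one_div_mul_eq_div, div_le_iff₀' (Nat.cast_pos.2 Fintype.card_pos)]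
  exact (Finset.sum_le_card_nsmul _ _ (M : ℝ) fun v _ => Nat.cast_le.2 (hd v)).trans_eq
    (nsmul_eq_mul _ _)

/- Absorbs the lower-order terms of `welfareRegret_le`, with `κ = log K`, `Δ` the average delay,
`β = K / N * α`, and `Λ`, `Λ'` the logarithms of the theorem and of `welfareRegret_le`. -/
theorem regret_terms_le_ten_mul {η T κ Δ β Λ Λ' : ℝ} (hη : 0 < η) (hT : 0 ≤ T)
    (hκ : Real.log 2 ≤ κ) (hΔ : 0 ≤ Δ) (hΔη : Δ * η ≤ Real.log 2) (hβ : 0 ≤ β)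
    (hβΛ : 1 ≤ β * Λ) (hΛ : 1 + Λ' ≤ 2 * Λ) :
    Δ * (2 + T * η) + (κ + 1) / η + 2 * η * T * (1 + 2 * β * (1 + Λ')) ≤
      10 * (κ / η + η * (Δ + β * Λ) * T) := by
  have hlog2 := Real.log_two_gt_d9
  have hdelay : Δ ≤ κ / η := (le_div_iff₀ hη).2 (hΔη.trans hκ)
  have hentropy : (κ + 1) / η ≤ 3 * (κ / η) := by
    rw [mul_div_assoc']
    gcongr
    linarith
  have hvariance : 2 * η * T * (1 + 2 * β * (1 + Λ')) ≤ 2 * η * T * (5 * (β * Λ)) := by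
    refine mul_le_mul_of_nonneg_left ?_ (by positivity)
    linarith [mul_le_mul_of_nonneg_left hΛ hβ]
  linarith [hΔ.trans hdelay, show 0 ≤ Δ * T * η by positivity]

variable {V A : Type*} [Fintype V] [Fintype A] {D : Digraph V} {d : V → ℕ} {η : ℝ}
  {ℓ : ℕ → A → ℝ} {T : ℕ}

theorem log_le_log_mul_card_mul_card [Nonempty V] [Nonempty A] (hT : 0 < T) :
    Real.log T ≤ Real.log (T * Fintype.card V * Fintype.card A) := by
  have hT' : (0 : ℝ) < T := Nat.cast_pos.2 hT
  refine Real.log_le_log hT' ?_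
  rw [mul_assoc]
  refine le_mul_of_one_le_right hT'.le ?_
  exact_mod_cast Nat.mul_pos (Fintype.card_pos (α := V)) (Fintype.card_pos (α := A))

theorem one_add_log_le_two_mul_log [Nonempty V] [Nonempty A] (hT : 0 < T)
    (hlog : 2 ≤ Real.log T) :
    1 + Real.log (2 * Fintype.card V * Fintype.card A / (1 / T)) ≤
      2 * Real.log (T * Fintype.card V * Fintype.card A) := by
  rw [div_div_eq_mul_div, div_one, show (2 : ℝ) * Fintype.card V * Fintype.card A * T =
    2 * (T * Fintype.card V * Fintype.card A) by ring, Real.log_mul two_ne_zero (by positivity)]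
  linarith [Real.log_two_lt_d9, log_le_log_mul_card_mul_card (V := V) (A := A) hT]

theorem welfareRegret_le_ten_mul [DecidableEq V] [Nonempty V] [Nontrivial A] {M : ℕ}
    (hD : ∀ v, D.Adj v v) (hd : ∀ v, d v ≤ M) (hη : 0 < η)
    (hηM : 4 * (M + 1) * Fintype.card A * η ≤ 1) (hT : 2 * (M + 1) ≤ T)
    (hlogV : Fintype.card V ≤ Real.log T) (hlog : 2 ≤ Real.log T) (hℓ0 : 0 ≤ ℓ) (hℓ1 : ℓ ≤ 1) :
    welfareRegret D d η (1 / T) ℓ T ≤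
      10 * (Real.log (Fintype.card A) / η + η * (avgDelay d +
        Fintype.card A / Fintype.card V * digraphIndepNum D *
          Real.log (T * Fintype.card V * Fintype.card A)) * T) := by
  have hT0 : (0 : ℝ) < T := Nat.cast_pos.2 (by omega)
  have hTM : 2 * ((M : ℝ) + 1) ≤ T := by exact_mod_cast hT
  have hV : (0 : ℝ) < Fintype.card V := Nat.cast_pos.2 Fintype.card_pos
  have hA : (2 : ℝ) ≤ Fintype.card A := by exact_mod_cast Fintype.one_lt_card (α := A)
  have hα : (1 : ℝ) ≤ digraphIndepNum D := by exact_mod_cast one_le_digraphIndepNum D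
  have hM : (0 : ℝ) < M + 1 := by positivity
  have hΛ := log_le_log_mul_card_mul_card (V := V) (A := A) (T := T) (by omega)
  have hρ1 : 1 / (2 * ((M : ℝ) + 1)) ≤ 1 := (div_le_one (by positivity)).2 (by linarith)
  have hδρ : 1 / (T : ℝ) ≤ 1 / (2 * ((M : ℝ) + 1)) := by gcongr
  have hstable (I : ℕ → V → A) (s : ℕ) (v : V) (i : A) :
      prob D d η (1 / T) ℓ I (s + d v) v i ≤ 2 * prob D d η (1 / T) ℓ I s v i := by
    have hdv : (d v : ℝ) ≤ M := Nat.cast_le.2 (hd v)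
    refine prob_add_delay_le_two_mul (hD v) hη.le (by positivity) hℓ0 hℓ1 hδρ hρ1 ?_ ?_ s i
    · rw [mul_one_div, div_le_one (by positivity)]
      linarith
    · rw [le_div_iff₀ (by positivity)]
      linarith
  have hΔη : avgDelay d * η ≤ Real.log 2 := by
    calc avgDelay d * η ≤ (M + 1) * η := by
          gcongr
          linarith [avgDelay_le hd]
      _ ≤ Real.log 2 := by
          linarith [Real.log_two_gt_d9, mul_le_mul_of_nonneg_left hA (mul_pos hM hη).le]
  have hβΛ : 1 ≤ Fintype.card A / Fintype.card V * digraphIndepNum D *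
      Real.log (T * Fintype.card V * Fintype.card A) := by
    rw [div_mul_eq_mul_div, div_mul_eq_mul_div, one_le_div hV]
    exact (hlogV.trans hΛ).trans (le_mul_of_one_le_left (by linarith)
      (one_le_mul_of_one_le_of_one_le (by linarith) hα))
  refine le_trans ?_ (regret_terms_le_ten_mul hη hT0.le (Real.log_le_log two_pos hA)
    (avgDelay_nonneg d) hΔη (by positivity) hβΛ (one_add_log_le_two_mul_log (by omega) hlog))
  refine (welfareRegret_le hD hη (by positivity) (hδρ.trans hρ1) hℓ0 hℓ1 hstable
    fun v => (hd v).trans (by omega)).trans_eq ?_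
  rw [mul_add (T : ℝ), mul_one_div_cancel hT0.ne']
  ring

end MainBound

end Exp3Coop2

open Exp3Coop2 in
theorem theoremt_general {V A : Type*} [Fintype V] [DecidableEq V] [Nonempty V] [Fintype A]
    [Nonempty A] {D : Digraph V} (hD : ∀ v, D.Adj v v) (d : V → ℕ) :
    ∃ η₀ : ℝ, 0 < η₀ ∧ ∀ᶠ T : ℕ in atTop, ∀ η : ℝ, 0 < η → η ≤ η₀ →
      ∀ ℓ : ℕ → A → ℝ, (∀ t i, ℓ t i ∈ Set.Icc (0 : ℝ) 1) →
        welfareRegret D d η (1 / T) ℓ T ≤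
          10 * (Real.log (Fintype.card A) / η + η * (avgDelay d +
            Fintype.card A / Fintype.card V * digraphIndepNum D *
              Real.log (T * Fintype.card V * Fintype.card A)) * T) := by
  have : (0 : ℝ) < Fintype.card A := Nat.cast_pos.2 Fintype.card_pos
  have hlogT : Tendsto (fun T : ℕ => Real.log T) atTop atTop :=
    Real.tendsto_log_atTop.comp tendsto_natCast_atTop_atTop
  set M := Finset.univ.sup d
  refine ⟨1 / (4 * (M + 1) * Fintype.card A), by positivity, ?_⟩
  filter_upwards [eventually_ge_atTop (2 * (M + 1)), hlogT.eventually_ge_atTop 2,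
    hlogT.eventually_ge_atTop (Fintype.card V : ℝ)] with T hT hlog hlogV η hη hη₀ ℓ hℓ
  rcases subsingleton_or_nontrivial A with _ | _
  · have hT0 : (0 : ℝ) < T := Nat.cast_pos.2 (by omega)
    have hΛ := hlog.trans (log_le_log_mul_card_mul_card (V := V) (A := A) (by omega))
    rw [welfareRegret_eq_zero (by positivity)]
    have := avgDelay_nonneg d
    positivity
  · exact welfareRegret_le_ten_mul hD (fun v => Finset.le_sup (Finset.mem_univ v)) hη
      ((le_div_iff₀' (by positivity)).1 hη₀) hT hlogV hlog (fun t i => (hℓ t i).1)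
      fun t i => (hℓ t i).2

theorem theoremt :
    ∃ C : ℝ, 0 < C ∧
      ∀ (K N : ℕ) [NeZero K] [NeZero N] (G : SimpleGraph (Fin N)) (d ttl : Fin N → ℕ)
        (η : ℕ → ℝ), (∀ T, 0 < η T) → Tendsto η atTop (𝓝 0) →
        ∀ᶠ T : ℕ in atTop, ∀ ℓ : ℕ → Fin K → ℝ, (∀ t i, ℓ t i ∈ Set.Icc (0 : ℝ) 1) →
          Exp3Coop2.welfareRegret (Exp3Coop2.commDigraph G d ttl) d (η T) (1 / (T : ℝ)) ℓ T ≤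
            C * (Real.log K / η T +
              η T * (Exp3Coop2.avgDelay d +
                (K : ℝ) / (N : ℝ) *
                  (Exp3Coop2.digraphIndepNum (Exp3Coop2.commDigraph G d ttl) : ℝ) *
                  Real.log ((T : ℝ) * N * K)) * T) := by
  refine ⟨10, by norm_num, fun K N _ _ G d ttl η hη hη0 => ?_⟩
  obtain ⟨η₀, hη₀, hbound⟩ :=
    theoremt_general (A := Fin K) (Exp3Coop2.commDigraph_adj_self G d ttl) d
  filter_upwards [hbound, hη0.eventually_le_const hη₀] with T hT hηT ℓ hℓ
  simpa only [Fintype.card_fin] using hT (η T) (hη T) hηT ℓ hℓ
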